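/- **Model.** Let $M\ge 2$ and $N\ge 1$. Let $(\Omega,\mathcal F,\mathrm P)$ be a probability space with a filtration $(\mathcal F_t)_{t\ge 0}$, let $X_t=(X_t^1,\dots,X_t^N)\in\mathbb R_+^N$, $t\ge1$, be adapted (asset payoffs), and let $\rho_t\ge 0$, $t\ge 1$, be predictable, i.e. $\mathcal F_{t-1}$-measurable (bank returns), with $\rho_t+\sum_n X_t^n>0$ a.s. for all $t\ge 1$. For $x\in\mathbb R^N$ write $|x|=\sum_n|x^n|$ and $\|x\|=(\sum_n (x^n)^2)^{1/2}$. Let $\Delta=\{\lambda\in\mathbb R_+^{MN}:\sum_n\lambda^{m,n}\le 1\text{ for each }m\}$. A *strategy* is a sequence of $\mathcal F_{t-1}\otimes\mathcal B(\mathbb R_+^M\times\Delta^{t-1})$-measurable functions $\Lambda_t(\omega,y_0,\lambda_1,\dots,\lambda_{t-1})\in[0,1]^N$, $t\ge1$, on $\Omega\times\mathbb R_+^M\times\Delta^{t-1}$ with $\sum_n\Lambda_t^n\le 1$. Given non-random initial capitals $Y_0^m>0$ and strategies $\Lambda^1,\dots,\Lambda^M$ of the $M$ investors, the realizations are defined recursively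 by $\lambda_t^{m}(\omega)=\Lambda_t^{m}(\omega,Y_0,\lambda_1(\omega),\dots,\lambda_{t-1}(\omega))$, and the wealth of the investors by $$Y_t^m=\rho_t\Bigl(1-\sum_n\lambda_t^{m,n}\Bigr)Y_{t-1}^m+\sum_n\frac{\lambda_t^{m,n}Y_{t-1}^m}{\sum_k\lambda_t^{k,n}Y_{t-1}^k}X_t^n,\qquad t\ge1\quad(0/0=0).$$ Put $W_t=\sum_m Y_t^m$ and $r_t^m=Y_t^m/W_t$ ($r_t^m=0$ if $W_t=0$). **The strategy $\hat\Lambda$.** Let $K_t(\omega,dx)$ be a regular conditional distribution of $X_t$ (on $\mathbb R_+^N$) with respect to $\mathcal F_{t-1}$. For $c\ge0$ let $\zeta_t(\omega,c)$ be the unique solution $z\in(0,c]$ of $\int\frac{c\rho_t(\omega)}{z\rho_t(\omega)+|x|}K_t(\omega,dx)=1$ if $\int\frac{c\rho_t(\omega)}{|x|}K_t(\omega,dx)>1$ (where $0/0=0$ and $a/0=+\infty$ for $a>0$), and $\zeta_t(\omega,c)=0$ otherwise. For a history $\chi_{t-1}=(y_0,\lambda_1,\dots,\lambda_{t-1})$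 let $C_{t-1}(\omega,\chi_{t-1})$ be the total wealth $\sum_m Y_{t-1}^m(\omega)$ given by the wealth equation with initial capital $y_0$ and proportions $\lambda_1,\dots,\lambda_{t-1}$. Then $$\hat\Lambda_t^n(\omega,\chi_{t-1})=\int_{\mathbb R_+^N}\frac{x^n}{\zeta_t(\omega,C_{t-1}(\omega,\chi_{t-1}))\,\rho_t(\omega)+|x|}\,K_t(\omega,dx)\qquad(0/0=0).$$ **Theorem.** Suppose investor 1 uses the strategy $\hat\Lambda$ and the other investors use arbitrary strategies. Let $\hat\lambda_t$ be the realization of investor 1's strategy and $\tilde\lambda_t=\sum_{m\ge2}\frac{r_{t-1}^m}{1-r_{t-1}^1}\lambda_t^m$ (with $\tilde\lambda_t=0$ if $r_{t-1}^1=1$) the realization of the representative strategy of the other investors. Then the set $$\Omega'=\Bigl\{\omega:\sum_{t\ge1}\|\hat\lambda_t(\omega)-\tilde\lambda_t(\omega)\|^2=\infty\Bigr\}$$ belongs to $\mathcal F$, and $r_t^1(\omega)\to1$ a.s. on $\Omega'$. In particular, the limit $\lim_{t\to\infty}r_t^1$ exists a.s., and $\|\hat\lambda_t(\omega)-\tilde\lambda_t(\omega)\|\to0$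 a.s. on the set $\{\omega:\lim_{t\to\infty}r_t^1(\omega)<1\}$. -/

import Mathlib

open MeasureTheory ProbabilityTheory Filter Topology
open scoped NNReal ENNReal

noncomputable section

namespace AssetMarket

/-- Vectors of investment proportions of one investor: no short sales, no borrowing. -/
abbrev Proportions (N : ℕ) : Type :=
  {l : Fin N → ℝ // (∀ n, 0 ≤ l n) ∧ ∑ n, l n ≤ 1}

/-- The first `t` rounds of moves `λ_1, …, λ_t` of all `M` investors;
the entry with index `s : Fin t` is `λ_{s+1}`. -/
abbrev Moves (M N t : ℕ) : Type := Fin t → Fin M → Proportions N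

/-- A market history `(y_0, λ_1, …, λ_t)`. -/
abbrev History (M N t : ℕ) : Type := (Fin M → ℝ≥0) × Moves M N t

/-- The exogenous data: payoffs `X_t` (adapted) and bank returns `ρ_t` (predictable), `t ≥ 1`.
The entries with index `0` are never used. -/
structure Market {Ω : Type*} {mΩ : MeasurableSpace Ω} (P : Measure Ω) (ℱ : Filtration ℕ mΩ)
    (N : ℕ) where
  X : ℕ → Ω → Fin N → ℝ≥0
  ρ : ℕ → Ω → ℝ≥0
  measurable_X : ∀ t, Measurable[ℱ (t + 1)] (X (t + 1))
  measurable_ρ : ∀ t, Measurable[ℱ t] (ρ (t + 1))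
  pos : ∀ t, ∀ᵐ ω ∂P, 0 < ρ (t + 1) ω + ∑ n, X (t + 1) ω n

/-- A strategy: `act t` is the function `Λ_{t+1}(ω, y_0, λ_1, …, λ_t)`, measurable with respect to
`ℱ_t ⊗ Borel`. -/
structure Strategy {Ω : Type*} {mΩ : MeasurableSpace Ω} (ℱ : Filtration ℕ mΩ) (M N : ℕ) where
  act : (t : ℕ) → Ω → History M N t → Proportions N
  measurable_act : ∀ t,
    Measurable[(ℱ t).prod (inferInstance : MeasurableSpace (History M N t))]
      (fun p : Ω × History M N t => act t p.1 p.2)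

/-- One step of the wealth equation. The quotient is `0` when nobody invests in the asset. -/
def wealthStep {M N : ℕ} (ρ : ℝ≥0) (x : Fin N → ℝ≥0) (l : Fin M → Proportions N)
    (y : Fin M → ℝ) (m : Fin M) : ℝ :=
  ρ * (1 - ∑ n, (l m).1 n) * y m +
    ∑ n, (l m).1 n * y m / (∑ k, (l k).1 n * y k) * x n

section Model

variable {Ω : Type*} {mΩ : MeasurableSpace Ω} {P : Measure Ω} {ℱ : Filtration ℕ mΩ} {M N : ℕ}

/-- Wealth `Y_t` of the investors after the history `(y_0, λ_1, …, λ_t)`. -/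
def Market.wealthOf (S : Market P ℱ N) (ω : Ω) (y₀ : Fin M → ℝ≥0) :
    (t : ℕ) → Moves M N t → Fin M → ℝ
  | 0, _ => fun m => y₀ m
  | t + 1, χ => wealthStep (S.ρ (t + 1) ω) (S.X (t + 1) ω) (χ (Fin.last t))
      (Market.wealthOf S ω y₀ t (Fin.init χ))

/-- Total wealth `C_t(ω, χ_t)` of all investors after the history `χ_t`. -/
def Market.totalWealthOf (S : Market P ℱ N) (t : ℕ) (ω : Ω) (χ : History M N t) : ℝ :=
  ∑ m, S.wealthOf ω χ.1 t χ.2 m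

/-- The moves `λ_1(ω), …, λ_t(ω)` realized when the investors use the strategy profile `L`. -/
def realizedMoves (L : Fin M → Strategy ℱ M N) (y₀ : Fin M → ℝ≥0) (ω : Ω) :
    (t : ℕ) → Moves M N t
  | 0 => Fin.elim0
  | t + 1 => Fin.snoc (α := fun _ => Fin M → Proportions N) (realizedMoves L y₀ ω t)
      (fun m => (L m).act t ω (y₀, realizedMoves L y₀ ω t))

/-- `realization L y₀ t ω m n` is the realized proportion `λ_{t+1}^{m,n}(ω)`. -/
def realization (L : Fin M → Strategy ℱ M N) (y₀ : Fin M → ℝ≥0) (t : ℕ) (ω : Ω)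
    (m : Fin M) (n : Fin N) : ℝ :=
  ((L m).act t ω (y₀, realizedMoves L y₀ ω t)).1 n

/-- The realized wealth `Y_t^m(ω)`. -/
def Market.wealth (S : Market P ℱ N) (L : Fin M → Strategy ℱ M N) (y₀ : Fin M → ℝ≥0)
    (t : ℕ) (ω : Ω) (m : Fin M) : ℝ :=
  S.wealthOf ω y₀ t (realizedMoves L y₀ ω t) m

/-- The relative wealth `r_t^m(ω) = Y_t^m / W_t` (it is `0` if `W_t = 0`). -/
def Market.relWealth (S : Market P ℱ N) (L : Fin M → Strategy ℱ M N) (y₀ : Fin M → ℝ≥0)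
    (t : ℕ) (ω : Ω) (m : Fin M) : ℝ :=
  S.wealth L y₀ t ω m / ∑ k, S.wealth L y₀ t ω k

/-- `S.representative L y₀ i t ω n` is the component `n` of the realization at time `t + 1` of the
representative strategy of the investors other than `i`: their realized proportions weighted by
`r_t^m / (1 - r_t^i)`. It is `0` if `r_t^i = 1`. -/
def Market.representative (S : Market P ℱ N) (L : Fin M → Strategy ℱ M N) (y₀ : Fin M → ℝ≥0)
    (i : Fin M) (t : ℕ) (ω : Ω) (n : Fin N) : ℝ :=
  ∑ m ∈ Finset.univ.erase i,
    S.relWealth L y₀ t ω m / (1 - S.relWealth L y₀ t ω i) * realization L y₀ t ω m n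

/-- The Euclidean distance, at time `t + 1`, between the realization of the strategy of investor
`i` and the realization of the representative strategy of the other investors. -/
def Market.distance (S : Market P ℱ N) (L : Fin M → Strategy ℱ M N) (y₀ : Fin M → ℝ≥0)
    (i : Fin M) (t : ℕ) (ω : Ω) : ℝ :=
  ‖WithLp.toLp 2 (fun n => realization L y₀ t ω i n - S.representative L y₀ i t ω n)‖

/-- A regular conditional distribution of the payoffs: `kernel t` is the conditional distribution
`K_{t+1}` of `X_{t+1}` with respect to `ℱ_t`. -/
structure PayoffKernel (S : Market P ℱ N) where
  kernel : (t : ℕ) → Kernel[ℱ t] Ω (Fin N → ℝ≥0)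
  prob : ∀ t ω, IsProbabilityMeasure (kernel t ω)
  version : ∀ t (A : Set (Fin N → ℝ≥0)), MeasurableSet A →
    (fun ω => (kernel t ω).real A) =ᵐ[P] P⟦S.X (t + 1) ⁻¹' A | ℱ t⟧

end Model

section Zeta

variable {N : ℕ}

/-- `∫ c ρ / (z ρ + |x|) κ(dx)`. In `ℝ≥0∞` one has `0 / 0 = 0` and `a / 0 = ∞` for `a > 0`. -/
def cashIntegral (κ : Measure (Fin N → ℝ≥0)) (ρ : ℝ≥0) (c z : ℝ) : ℝ≥0∞ :=
  ∫⁻ x, ENNReal.ofReal (c * ρ) / ENNReal.ofReal (z * ρ + ∑ n, (x n : ℝ)) ∂κ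

/-- Membership of `(ω, c)` in `Γ_t`, for `κ = K_t(ω, ·)` and `ρ = ρ_t(ω)`. -/
def InGamma (κ : Measure (Fin N → ℝ≥0)) (ρ : ℝ≥0) (c : ℝ) : Prop :=
  1 < cashIntegral κ ρ c 0

theorem InGamma.pos {κ : Measure (Fin N → ℝ≥0)} {ρ : ℝ≥0} {c : ℝ} (h : InGamma κ ρ c) :
    0 < c ∧ 0 < ρ := by
  by_contra hn
  have h0 : c * ρ ≤ 0 := by
    rcases not_and_or.1 hn with hc | hr
    · exact mul_nonpos_of_nonpos_of_nonneg (not_lt.1 hc) ρ.2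
    · have : ρ = 0 := le_antisymm (not_lt.1 hr) bot_le
      simp [this]
  unfold InGamma cashIntegral at h
  simp [ENNReal.ofReal_of_nonpos h0] at h

theorem measurable_cashIntegrand (ρ : ℝ≥0) (c z : ℝ) :
    Measurable (fun x : Fin N → ℝ≥0 =>
      ENNReal.ofReal (c * ρ) / ENNReal.ofReal (z * ρ + ∑ n, (x n : ℝ))) := by
  fun_prop

theorem cashIntegral_antitone (κ : Measure (Fin N → ℝ≥0)) (ρ : ℝ≥0) (c : ℝ) :
    Antitone (cashIntegral κ ρ c) := by
  intro z w hzw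
  unfold cashIntegral
  gcongr

theorem cashIntegrand_le {ρ : ℝ≥0} (c : ℝ) {z : ℝ} (x : Fin N → ℝ≥0) :
    ENNReal.ofReal (c * ρ) / ENNReal.ofReal (z * ρ + ∑ n, (x n : ℝ)) ≤
      ENNReal.ofReal (c * ρ) / ENNReal.ofReal (z * ρ) := by
  gcongr
  have : 0 ≤ ∑ n, (x n : ℝ) := Finset.sum_nonneg fun n _ => (x n).2
  linarith

theorem bound_ne_top {ρ : ℝ≥0} (c : ℝ) {z : ℝ} (hz : 0 < z) (hρ : 0 < ρ) :
    ENNReal.ofReal (c * ρ) / ENNReal.ofReal (z * ρ) ≠ ∞ := by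
  have : 0 < z * (ρ : ℝ) := mul_pos hz (by exact_mod_cast hρ)
  exact ENNReal.div_ne_top ENNReal.ofReal_ne_top (by simpa using this)

theorem cashIntegral_ne_top (κ : Measure (Fin N → ℝ≥0)) [IsProbabilityMeasure κ] {ρ : ℝ≥0}
    (c : ℝ) {z : ℝ} (hz : 0 < z) (hρ : 0 < ρ) : cashIntegral κ ρ c z ≠ ∞ := by
  refine ne_top_of_le_ne_top (bound_ne_top c hz hρ) ?_
  calc cashIntegral κ ρ c z ≤ ∫⁻ _, ENNReal.ofReal (c * ρ) / ENNReal.ofReal (z * ρ) ∂κ :=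
        lintegral_mono fun x => cashIntegrand_le c x
    _ = _ := by simp

theorem cashIntegral_strictAnti (κ : Measure (Fin N → ℝ≥0)) [IsProbabilityMeasure κ] {ρ : ℝ≥0}
    {c z w : ℝ} (hc : 0 < c) (hρ : 0 < ρ) (hz : 0 ≤ z) (hzw : z < w) :
    cashIntegral κ ρ c w < cashIntegral κ ρ c z := by
  have hρ' : (0 : ℝ) < ρ := by exact_mod_cast hρ
  refine lintegral_strict_mono (IsProbabilityMeasure.ne_zero κ)
    (measurable_cashIntegrand ρ c z).aemeasurable
    (cashIntegral_ne_top κ c (hz.trans_lt hzw) hρ) (Eventually.of_forall fun x => ?_)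
  have hx : 0 ≤ ∑ n, (x n : ℝ) := Finset.sum_nonneg fun n _ => (x n).2
  have hlt : z * ρ + ∑ n, (x n : ℝ) < w * ρ + ∑ n, (x n : ℝ) := by
    have := mul_lt_mul_of_pos_right hzw hρ'
    linarith
  have hw : 0 < w * ρ + ∑ n, (x n : ℝ) := by
    have := mul_pos (hz.trans_lt hzw) hρ'
    linarith
  refine ENNReal.div_lt_div_left ?_ ENNReal.ofReal_ne_top ?_
  · simpa using mul_pos hc hρ'
  · exact (ENNReal.ofReal_lt_ofReal_iff hw).2 hlt

theorem tendsto_cashIntegrand {ρ : ℝ≥0} {c : ℝ} (z : ℝ) (x : Fin N → ℝ≥0) :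
    Tendsto (fun w : ℝ => ENNReal.ofReal (c * ρ) / ENNReal.ofReal (w * ρ + ∑ n, (x n : ℝ)))
      (𝓝 z) (𝓝 (ENNReal.ofReal (c * ρ) / ENNReal.ofReal (z * ρ + ∑ n, (x n : ℝ)))) := by
  refine ENNReal.Tendsto.const_div ?_ (Or.inr ENNReal.ofReal_ne_top)
  exact (ENNReal.continuous_ofReal.comp (by fun_prop)).tendsto z

theorem exists_zeta (κ : Measure (Fin N → ℝ≥0)) [IsProbabilityMeasure κ] {ρ : ℝ≥0} {c : ℝ}
    (h : InGamma κ ρ c) : ∃ z : ℝ, (0 < z ∧ z ≤ c) ∧ cashIntegral κ ρ c z = 1 := by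
  obtain ⟨hc, hρ⟩ := h.pos
  have hρ' : (0 : ℝ) < ρ := by exact_mod_cast hρ
  have hle : cashIntegral κ ρ c c ≤ 1 := by
    calc cashIntegral κ ρ c c ≤ ∫⁻ _, ENNReal.ofReal (c * ρ) / ENNReal.ofReal (c * ρ) ∂κ :=
          lintegral_mono fun x => cashIntegrand_le c x
      _ = ENNReal.ofReal (c * ρ) / ENNReal.ofReal (c * ρ) := by simp
      _ ≤ 1 := ENNReal.div_self_le_one
  obtain ⟨z₀, hz₀, h1⟩ : ∃ z₀ : ℝ, 0 < z₀ ∧ 1 < cashIntegral κ ρ c z₀ := by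
    by_contra! hcon
    have hF := lintegral_liminf_le' (μ := κ) (u := 𝓝[>] (0 : ℝ))
      (f := fun (w : ℝ) (x : Fin N → ℝ≥0) =>
        ENNReal.ofReal (c * ρ) / ENNReal.ofReal (w * ρ + ∑ n, (x n : ℝ)))
      (fun w => (measurable_cashIntegrand ρ c w).aemeasurable)
    have hlim : ∀ x : Fin N → ℝ≥0, liminf (fun w : ℝ =>
        ENNReal.ofReal (c * ρ) / ENNReal.ofReal (w * ρ + ∑ n, (x n : ℝ))) (𝓝[>] (0 : ℝ)) =
        ENNReal.ofReal (c * ρ) / ENNReal.ofReal (0 * ρ + ∑ n, (x n : ℝ)) := fun x =>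
      ((tendsto_cashIntegrand 0 x).mono_left nhdsWithin_le_nhds).liminf_eq
    simp only [hlim] at hF
    have hev : ∀ᶠ w in 𝓝[>] (0 : ℝ), cashIntegral κ ρ c w ≤ 1 := by
      filter_upwards [self_mem_nhdsWithin] with w hw using hcon w hw
    have h2 : liminf (fun w : ℝ => cashIntegral κ ρ c w) (𝓝[>] (0 : ℝ)) ≤ 1 :=
      (liminf_le_liminf hev).trans (by simp)
    exact absurd (lt_of_lt_of_le h (hF.trans h2)) (lt_irrefl _)
  have hz₀c : z₀ ≤ c := by
    by_contra! hlt
    exact absurd (h1.trans_le ((cashIntegral_antitone κ ρ c hlt.le).trans hle)) (lt_irrefl _)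
  have hcont : ContinuousOn (cashIntegral κ ρ c) (Set.Icc z₀ c) := by
    intro z hz
    have hz0 : 0 < z := hz₀.trans_le hz.1
    refine ContinuousAt.continuousWithinAt ?_
    refine tendsto_lintegral_filter_of_dominated_convergence
      (fun _ => ENNReal.ofReal (c * ρ) / ENNReal.ofReal (z / 2 * ρ))
      (Eventually.of_forall fun w => measurable_cashIntegrand ρ c w) ?_ ?_
      (Eventually.of_forall fun x => tendsto_cashIntegrand z x)
    · filter_upwards [lt_mem_nhds (half_lt_self hz0)] with w hw
      refine Eventually.of_forall fun x => (cashIntegrand_le c x).trans ?_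
      gcongr
    · simpa using bound_ne_top c (half_pos hz0) hρ
  obtain ⟨z, hz, hz1⟩ := intermediate_value_Icc' hz₀c hcont ⟨hle, h1.le⟩
  exact ⟨z, ⟨hz₀.trans_le hz.1, hz.2⟩, hz1⟩

open Classical in
/-- `ζ`: on `Γ` the (unique) solution `z ∈ (0, c]` of `∫ c ρ / (z ρ + |x|) κ(dx) = 1`, and `0`
outside `Γ`. -/
def zeta (κ : Measure (Fin N → ℝ≥0)) [IsProbabilityMeasure κ] (ρ : ℝ≥0) (c : ℝ) : ℝ :=
  if h : InGamma κ ρ c then (exists_zeta κ h).choose else 0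

theorem zeta_spec (κ : Measure (Fin N → ℝ≥0)) [IsProbabilityMeasure κ] {ρ : ℝ≥0} {c : ℝ}
    (h : InGamma κ ρ c) :
    (0 < zeta κ ρ c ∧ zeta κ ρ c ≤ c) ∧ cashIntegral κ ρ c (zeta κ ρ c) = 1 := by
  rw [zeta, dif_pos h]
  exact (exists_zeta κ h).choose_spec

theorem zeta_nonneg (κ : Measure (Fin N → ℝ≥0)) [IsProbabilityMeasure κ] (ρ : ℝ≥0) (c : ℝ) :
    0 ≤ zeta κ ρ c := by
  by_cases h : InGamma κ ρ c
  · exact (zeta_spec κ h).1.1.le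
  · rw [zeta, dif_neg h]

theorem lt_zeta_iff (κ : Measure (Fin N → ℝ≥0)) [IsProbabilityMeasure κ] (ρ : ℝ≥0) (c : ℝ)
    {a : ℝ} (ha : 0 ≤ a) : a < zeta κ ρ c ↔ 1 < cashIntegral κ ρ c a := by
  by_cases h : InGamma κ ρ c
  · obtain ⟨-, hz⟩ := zeta_spec κ h
    constructor
    · intro hlt
      rw [← hz]
      exact cashIntegral_strictAnti κ h.pos.1 h.pos.2 ha hlt
    · intro hlt
      by_contra! hle
      have := cashIntegral_antitone κ ρ c hle
      rw [hz] at this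
      exact absurd (hlt.trans_le this) (lt_irrefl _)
  · rw [zeta, dif_neg h]
    constructor
    · intro hlt
      exact absurd (hlt.trans_le ha) (lt_irrefl _)
    · intro hlt
      exact absurd (hlt.trans_le (cashIntegral_antitone κ ρ c ha)) h

theorem measurable_zeta {A : Type*} [MeasurableSpace A] (κ : Kernel A (Fin N → ℝ≥0))
    [hκ : ∀ a, IsProbabilityMeasure (κ a)] {ρ : A → ℝ≥0} (hρ : Measurable ρ) {c : A → ℝ}
    (hc : Measurable c) : Measurable (fun a => zeta (κ a) (ρ a) (c a)) := by
  have : IsMarkovKernel κ := ⟨hκ⟩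
  refine measurable_of_Ioi fun b => ?_
  rcases lt_or_ge b 0 with hb | hb
  · convert MeasurableSet.univ
    ext a
    simpa using hb.trans_le (zeta_nonneg (κ a) (ρ a) (c a))
  · have heq : (fun a => zeta (κ a) (ρ a) (c a)) ⁻¹' Set.Ioi b =
        {a | 1 < cashIntegral (κ a) (ρ a) (c a) b} := by
      ext a
      exact lt_zeta_iff (κ a) (ρ a) (c a) hb
    rw [heq]
    refine measurableSet_lt measurable_const ?_
    unfold cashIntegral
    exact Measurable.lintegral_kernel_prod_right' (κ := κ)
      (f := fun p : A × (Fin N → ℝ≥0) =>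
        ENNReal.ofReal (c p.1 * ρ p.1) / ENNReal.ofReal (b * ρ p.1 + ∑ n, (p.2 n : ℝ)))
      (by fun_prop)

end Zeta

section Optimal

variable {N : ℕ}

/-- `∫ x^n / (z ρ + |x|) κ(dx)`, with `0 / 0 = 0`. -/
def optimalShare (κ : Measure (Fin N → ℝ≥0)) (ρ : ℝ≥0) (z : ℝ) (n : Fin N) : ℝ :=
  ∫ x, (x n : ℝ) / (z * ρ + ∑ k, (x k : ℝ)) ∂κ

theorem optimalShare_nonneg (κ : Measure (Fin N → ℝ≥0)) (ρ : ℝ≥0) {z : ℝ} (hz : 0 ≤ z)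
    (n : Fin N) : 0 ≤ optimalShare κ ρ z n :=
  integral_nonneg fun x => by positivity

theorem sum_optimalShare_le (κ : Measure (Fin N → ℝ≥0)) [IsProbabilityMeasure κ] (ρ : ℝ≥0)
    {z : ℝ} (hz : 0 ≤ z) : ∑ n, optimalShare κ ρ z n ≤ 1 := by
  have hpt : ∀ x : Fin N → ℝ≥0, ∑ n, (x n : ℝ) / (z * ρ + ∑ k, (x k : ℝ)) ≤ 1 := by
    intro x
    rw [← Finset.sum_div]
    refine div_le_one_of_le₀ ?_ (by positivity)
    have : 0 ≤ z * (ρ : ℝ) := by positivity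
    linarith
  have hint : ∀ n, Integrable (fun x : Fin N → ℝ≥0 =>
      (x n : ℝ) / (z * ρ + ∑ k, (x k : ℝ))) κ := by
    intro n
    have hm : Measurable (fun x : Fin N → ℝ≥0 =>
        (x n : ℝ) / (z * ρ + ∑ k, (x k : ℝ))) := by fun_prop
    refine Integrable.of_bound (C := 1) hm.aestronglyMeasurable (Eventually.of_forall fun x => ?_)
    rw [Real.norm_of_nonneg (by positivity)]
    refine le_trans ?_ (hpt x)
    exact Finset.single_le_sum (f := fun n => (x n : ℝ) / (z * ρ + ∑ k, (x k : ℝ)))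
      (fun k _ => by positivity) (Finset.mem_univ n)
  unfold optimalShare
  rw [← integral_finsetSum _ fun n _ => hint n]
  calc _ ≤ ∫ _, (1 : ℝ) ∂κ :=
        integral_mono (integrable_finsetSum _ fun n _ => hint n) (integrable_const _) hpt
    _ = 1 := by simp

theorem measurable_optimalShare {A : Type*} [MeasurableSpace A] (κ : Kernel A (Fin N → ℝ≥0))
    [hκ : ∀ a, IsProbabilityMeasure (κ a)] {ρ : A → ℝ≥0} (hρ : Measurable ρ) {z : A → ℝ}
    (hz : Measurable z) (n : Fin N) :
    Measurable (fun a => optimalShare (κ a) (ρ a) (z a) n) := by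
  have : IsMarkovKernel κ := ⟨hκ⟩
  unfold optimalShare
  have hm : Measurable (fun p : A × (Fin N → ℝ≥0) =>
      (p.2 n : ℝ) / (z p.1 * ρ p.1 + ∑ k, (p.2 k : ℝ))) := by fun_prop
  exact (StronglyMeasurable.integral_kernel_prod_right' (κ := κ) hm.stronglyMeasurable).measurable

variable {Ω : Type*} {mΩ : MeasurableSpace Ω} {P : Measure Ω} {ℱ : Filtration ℕ mΩ} {M : ℕ}

theorem Market.measurable_wealthOf (S : Market P ℱ N) (t : ℕ) (m : Fin M) :
    Measurable[(ℱ t).prod (inferInstance : MeasurableSpace (History M N t))]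
      (fun p : Ω × History M N t => S.wealthOf p.1 p.2.1 t p.2.2 m) := by
  induction t generalizing m with
  | zero =>
    let _ : MeasurableSpace Ω := ℱ 0
    change Measurable (fun p : Ω × History M N 0 => ((p.2.1 m : ℝ≥0) : ℝ))
    fun_prop
  | succ t ih =>
    have hX := S.measurable_X t
    have hρ : Measurable[ℱ (t + 1)] (S.ρ (t + 1)) :=
      (S.measurable_ρ t).mono (ℱ.mono (Nat.le_succ t)) le_rfl
    have ih' : ∀ m : Fin M,
        Measurable[(ℱ (t + 1)).prod (inferInstance : MeasurableSpace (History M N t))]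
          (fun p : Ω × History M N t => S.wealthOf p.1 p.2.1 t p.2.2 m) := fun m =>
      (ih m).mono (sup_le_sup
        (MeasurableSpace.comap_mono (ℱ.mono (Nat.le_succ t))) le_rfl) le_rfl
    clear ih
    let _ : MeasurableSpace Ω := ℱ (t + 1)
    have hinit : Measurable (fun p : Ω × History M N (t + 1) =>
        ((p.1, (p.2.1, Fin.init p.2.2)) : Ω × History M N t)) := by
      unfold Fin.init
      fun_prop
    have hY : ∀ k : Fin M, Measurable (fun p : Ω × History M N (t + 1) =>
        S.wealthOf p.1 p.2.1 t (Fin.init p.2.2) k) := fun k => (ih' k).comp hinit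
    have hl : ∀ (k : Fin M) (n : Fin N), Measurable (fun p : Ω × History M N (t + 1) =>
        (p.2.2 (Fin.last t) k).1 n) := by
      intro k n
      exact (measurable_pi_apply n).comp (measurable_subtype_coe.comp (by fun_prop))
    simp only [Market.wealthOf, wealthStep]
    have hX' : ∀ n : Fin N, Measurable (fun p : Ω × History M N (t + 1) =>
        ((S.X (t + 1) p.1 n : ℝ≥0) : ℝ)) := by
      intro n
      exact measurable_coe_nnreal_real.comp
        ((measurable_pi_apply n).comp (hX.comp measurable_fst))
    have hρ' : Measurable (fun p : Ω × History M N (t + 1) =>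
        ((S.ρ (t + 1) p.1 : ℝ≥0) : ℝ)) :=
      measurable_coe_nnreal_real.comp (hρ.comp measurable_fst)
    refine Measurable.add ((hρ'.mul (measurable_const.sub
      (Finset.measurable_sum _ fun n _ => hl m n))).mul (hY m))
      (Finset.measurable_sum _ fun n _ => (((hl m n).mul (hY m)).div
        (Finset.measurable_sum _ fun k _ => (hl k n).mul (hY k))).mul (hX' n))

/-- `ζ_{t+1}(ω, C_t(ω, χ_t))`. -/
def optimalZeta (S : Market P ℱ N) (K : PayoffKernel S) (t : ℕ) (ω : Ω) (χ : History M N t) : ℝ :=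
  haveI := K.prob t ω
  zeta (K.kernel t ω) (S.ρ (t + 1) ω) (S.totalWealthOf t ω χ)

theorem optimalZeta_nonneg (S : Market P ℱ N) (K : PayoffKernel S) (t : ℕ) (ω : Ω)
    (χ : History M N t) : 0 ≤ optimalZeta S K t ω χ :=
  haveI := K.prob t ω
  zeta_nonneg _ _ _

/-- The strategy `Λ̂`:
`Λ̂_{t+1}^n(ω, χ_t) = ∫ x^n / (ζ_{t+1}(ω, C_t(ω, χ_t)) ρ_{t+1}(ω) + |x|) K_{t+1}(ω, dx)`. -/
def optimalStrategy (M : ℕ) (S : Market P ℱ N) (K : PayoffKernel S) : Strategy ℱ M N where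
  act t ω χ :=
    ⟨fun n => optimalShare (K.kernel t ω) (S.ρ (t + 1) ω) (optimalZeta S K t ω χ) n,
      fun n => optimalShare_nonneg _ _ (optimalZeta_nonneg S K t ω χ) n,
      haveI := K.prob t ω
      sum_optimalShare_le _ _ (optimalZeta_nonneg S K t ω χ)⟩
  measurable_act t := by
    have hρ := S.measurable_ρ t
    have hW := fun m : Fin M => S.measurable_wealthOf t m
    let _ : MeasurableSpace Ω := ℱ t
    let κ : Kernel (Ω × History M N t) (Fin N → ℝ≥0) :=
      Kernel.comap (K.kernel t) Prod.fst measurable_fst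
    have : ∀ p, IsProbabilityMeasure (κ p) := fun p => K.prob t p.1
    have hρ' : Measurable (fun p : Ω × History M N t => S.ρ (t + 1) p.1) :=
      hρ.comp measurable_fst
    have hC : Measurable (fun p : Ω × History M N t => S.totalWealthOf t p.1 p.2) :=
      Finset.measurable_sum _ fun m _ => hW m
    refine Measurable.subtype_mk (measurable_pi_iff.2 fun n => ?_)
    exact measurable_optimalShare κ hρ' (measurable_zeta κ hρ' hC) n

end Optimal

end AssetMarket

end

noncomputable section

namespace AssetMarket

/-! The process `-log r_t`, with `r_t` the relative wealth of the investor using `optimalStrategy`,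
is a nonnegative supermartingale whose conditional decrease is at least `(1 - r_t)² d_t² / 4`, where
`d_t` is the distance to the representative strategy. Hence `r_t` converges a.s. to a positive limit
and `∑ (1 - r_t)² d_t²` is a.s. finite. Where the limit is below 1, the weights `(1 - r_t)²` are
eventually bounded away from 0, so `∑ d_t²` is finite and `d_t → 0`; divergence of `∑ d_t²`
therefore forces the limit to be 1.

The one-step bound goes as follows. Let `c` be the total wealth, `l` the optimal proportions, `μ`
the wealth-weighted mean proportions of all investors (`meanShare`), and `D = ζρ + |x|`. The new
relative wealth is `r (A/D) / (W/D)`, where `A = ζρ + ∑ x_n l_n/μ_n` and `W` is the new total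
wealth. Jensen with weights `ζρ/D, x_n/D` gives `log (A/D) ≥ ∑ (x_n/D) log (l_n/μ_n)`, while `log
(W/D) ≤ W/D - 1 = (∑ l_n - ∑ μ_n) cρ/D`. Under the conditional law of the payoffs `x_n/D` has mean
`l_n`, and `cρ/D` has mean 1, or at most 1 when `∑ l_n = 1`. What remains is the generalized
relative entropy `∑ (l_n log (l_n/μ_n) - l_n + μ_n)`, which is at least `∑ (l_n - μ_n)²/4`. Finally
`l - μ` is `1 - r` times the difference from the representative strategy. -/

theorem sq_sub_div_four_le_mul_log {a b : ℝ} (ha : 0 ≤ a) (ha1 : a ≤ 1) (hb : 0 ≤ b)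
    (hb1 : b ≤ 1) (hab : b = 0 → a = 0) :
    (a - b) ^ 2 / 4 ≤ a * Real.log (a / b) - a + b := by
  rcases ha.eq_or_lt with rfl | ha0
  · nlinarith
  have hb0 : 0 < b := lt_of_le_of_ne hb fun h => ha0.ne' (hab h.symm)
  -- In square roots, `log u ≤ u - 1` at `u = t/s` bounds the right side below by `(s - t)²`. Since
  -- `s + t ≤ 2`, this is at least `(s² - t²)²/4`, which is where the 4 comes from.
  obtain ⟨s, hs, rfl⟩ : ∃ s : ℝ, 0 < s ∧ s ^ 2 = a :=
    ⟨√a, Real.sqrt_pos.2 ha0, Real.sq_sqrt ha⟩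
  obtain ⟨t, ht, rfl⟩ : ∃ t : ℝ, 0 < t ∧ t ^ 2 = b :=
    ⟨√b, Real.sqrt_pos.2 hb0, Real.sq_sqrt hb⟩
  have hs1 : s ≤ 1 := by nlinarith
  have ht1 : t ≤ 1 := by nlinarith
  have hlog : Real.log (s ^ 2 / t ^ 2) = -(2 * Real.log (t / s)) := by
    rw [← div_pow, Real.log_pow, ← inv_div, Real.log_inv]
    push_cast
    ring
  have hle : s ^ 2 * Real.log (t / s) ≤ s ^ 2 * (t / s - 1) :=
    mul_le_mul_of_nonneg_left (Real.log_le_sub_one_of_pos (div_pos ht hs)) (by positivity)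
  have heq : s ^ 2 * (t / s - 1) = s * t - s ^ 2 := by
    field_simp
  have hsq : (s + t) ^ 2 ≤ 4 := by nlinarith
  have hprod : (s - t) ^ 2 * (s + t) ^ 2 ≤ (s - t) ^ 2 * 4 :=
    mul_le_mul_of_nonneg_left hsq (sq_nonneg _)
  rw [hlog]
  nlinarith

/-- Jensen for `log` with an extra atom of mass `p₀` at the value 1, which stands for cash and
contributes `log 1 = 0`. The proof sums the tangent-line bounds of `log` at `S`; an atom at 0 has no
mass, so the convention `log 0 = 0` does no harm. -/
theorem sum_mul_log_le_log_add_sum {ι : Type*} [Fintype ι] {p₀ : ℝ} {p q : ι → ℝ} (hp₀ : 0 ≤ p₀)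
    (hp : ∀ n, 0 ≤ p n) (hsum : p₀ + ∑ n, p n = 1) (hq : ∀ n, 0 ≤ q n)
    (hpq : ∀ n, q n = 0 → p n = 0) (hS : 0 < p₀ + ∑ n, p n * q n) :
    ∑ n, p n * Real.log (q n) ≤ Real.log (p₀ + ∑ n, p n * q n) := by
  set S := p₀ + ∑ n, p n * q n with hSdef
  have hterm : ∀ n, p n * Real.log (q n) ≤ p n * Real.log S + p n * q n / S - p n := by
    intro n
    rcases (hq n).eq_or_lt with h0 | h0
    · simp [hpq n h0.symm]
    have h := mul_le_mul_of_nonneg_left (Real.log_le_sub_one_of_pos (div_pos h0 hS)) (hp n)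
    rw [Real.log_div h0.ne' hS.ne', mul_sub, mul_sub, ← mul_div_assoc] at h
    linarith
  have h₀ : 0 ≤ p₀ * Real.log S + p₀ / S - p₀ := by
    have h := mul_le_mul_of_nonneg_left (Real.one_sub_inv_le_log_of_pos hS) hp₀
    rw [mul_sub, mul_one, ← div_eq_mul_inv] at h
    linarith
  have hs := Finset.sum_le_sum fun n (_ : n ∈ Finset.univ) => hterm n
  rw [Finset.sum_sub_distrib, Finset.sum_add_distrib, ← Finset.sum_mul, ← Finset.sum_div] at hs
  have h1 : p₀ / S + (∑ n, p n * q n) / S = 1 := by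
    rw [← add_div, ← hSdef, div_self hS.ne']
  have h2 : p₀ * Real.log S + (∑ n, p n) * Real.log S = Real.log S := by
    rw [← add_mul, hsum, one_mul]
  linarith

/-! ### The optimal proportions and the equation for `zeta` -/

section Zeta

variable {N : ℕ}

/-- Outside `InGamma`, where `zeta` vanishes, a positive `ρ` makes the integrand of `cashIntegral κ
ρ c 0` infinite at `x = 0`; as that integral is at most 1, `x = 0` has measure zero. This makes real
division agree with division in `ℝ≥0∞` below. -/
theorem ae_pos_zeta (κ : Measure (Fin N → ℝ≥0)) [IsProbabilityMeasure κ] {ρ : ℝ≥0} {c : ℝ}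
    (hc : 0 < c) (hpos : ∀ᵐ x ∂κ, 0 < ρ + ∑ n, x n) :
    ∀ᵐ x ∂κ, 0 < zeta κ ρ c * ρ + ∑ n, (x n : ℝ) := by
  by_cases h : InGamma κ ρ c
  · refine Eventually.of_forall fun x => ?_
    have hρ : (0 : ℝ) < ρ := by exact_mod_cast h.pos.2
    have := mul_pos (zeta_spec κ h).1.1 hρ
    positivity
  · rw [zeta, dif_neg h]
    rcases eq_or_ne ρ 0 with rfl | hρ
    · filter_upwards [hpos] with x hx
      simpa using (by exact_mod_cast hx : (0 : ℝ) < (0 : ℝ≥0) + ∑ n, (x n : ℝ))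
    · have hfin : cashIntegral κ ρ c 0 ≠ ∞ := ne_top_of_le_ne_top ENNReal.one_ne_top (not_lt.1 h)
      filter_upwards [ae_lt_top (measurable_cashIntegrand ρ c 0) hfin] with x hx
      by_contra hn
      have h0 : ENNReal.ofReal (0 * ρ + ∑ n, (x n : ℝ)) = 0 :=
        ENNReal.ofReal_of_nonpos (not_lt.1 hn)
      have hcρ : ENNReal.ofReal (c * ρ) ≠ 0 := by
        have : 0 < c * (ρ : ℝ) := mul_pos hc (by exact_mod_cast pos_iff_ne_zero.2 hρ)
        simpa using this
      rw [h0, ENNReal.div_zero hcρ] at hx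
      exact lt_irrefl _ hx

theorem lintegral_cash_zeta (κ : Measure (Fin N → ℝ≥0)) [IsProbabilityMeasure κ] {ρ : ℝ≥0} {c : ℝ}
    (hc : 0 < c) (hpos : ∀ᵐ x ∂κ, 0 < ρ + ∑ n, x n) :
    ∫⁻ x, ENNReal.ofReal (c * ρ / (zeta κ ρ c * ρ + ∑ n, (x n : ℝ))) ∂κ =
      cashIntegral κ ρ c (zeta κ ρ c) := by
  refine lintegral_congr_ae ?_
  filter_upwards [ae_pos_zeta κ hc hpos] with x hx
  exact ENNReal.ofReal_div_of_pos hx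

theorem cashIntegral_zeta_le_one (κ : Measure (Fin N → ℝ≥0)) [IsProbabilityMeasure κ] (ρ : ℝ≥0)
    (c : ℝ) : cashIntegral κ ρ c (zeta κ ρ c) ≤ 1 := by
  by_cases h : InGamma κ ρ c
  · exact (zeta_spec κ h).2.le
  · rw [zeta, dif_neg h]
    exact not_lt.1 h

theorem cash_nonneg (κ : Measure (Fin N → ℝ≥0)) [IsProbabilityMeasure κ] {ρ : ℝ≥0} {c : ℝ}
    (hc : 0 < c) (x : Fin N → ℝ≥0) : 0 ≤ c * ρ / (zeta κ ρ c * ρ + ∑ n, (x n : ℝ)) := by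
  have := zeta_nonneg κ ρ c
  positivity

theorem integrable_cash_zeta (κ : Measure (Fin N → ℝ≥0)) [IsProbabilityMeasure κ] {ρ : ℝ≥0}
    {c : ℝ} (hc : 0 < c) (hpos : ∀ᵐ x ∂κ, 0 < ρ + ∑ n, x n) :
    Integrable (fun x : Fin N → ℝ≥0 => c * ρ / (zeta κ ρ c * ρ + ∑ n, (x n : ℝ))) κ := by
  refine ⟨Measurable.aestronglyMeasurable (by fun_prop), ?_⟩
  rw [hasFiniteIntegral_iff_ofReal (Eventually.of_forall (cash_nonneg κ hc)),
    lintegral_cash_zeta κ hc hpos]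
  exact (cashIntegral_zeta_le_one κ ρ c).trans_lt ENNReal.one_lt_top

theorem integral_cash_zeta (κ : Measure (Fin N → ℝ≥0)) [IsProbabilityMeasure κ] {ρ : ℝ≥0}
    {c : ℝ} (hc : 0 < c) (hpos : ∀ᵐ x ∂κ, 0 < ρ + ∑ n, x n) :
    ∫ x, c * ρ / (zeta κ ρ c * ρ + ∑ n, (x n : ℝ)) ∂κ =
      (cashIntegral κ ρ c (zeta κ ρ c)).toReal := by
  rw [integral_eq_lintegral_of_nonneg_ae (Eventually.of_forall (cash_nonneg κ hc))
    (integrable_cash_zeta κ hc hpos).1, lintegral_cash_zeta κ hc hpos]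

theorem integrable_share (κ : Measure (Fin N → ℝ≥0)) [IsProbabilityMeasure κ] (ρ : ℝ≥0) {z : ℝ}
    (hz : 0 ≤ z) (n : Fin N) :
    Integrable (fun x : Fin N → ℝ≥0 => (x n : ℝ) / (z * ρ + ∑ k, (x k : ℝ))) κ := by
  refine Integrable.of_bound (C := 1) (Measurable.aestronglyMeasurable (by fun_prop))
    (Eventually.of_forall fun x => ?_)
  rw [Real.norm_of_nonneg (by positivity)]
  refine div_le_one_of_le₀ ?_ (by positivity)
  have h1 : (x n : ℝ) ≤ ∑ k, (x k : ℝ) :=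
    Finset.single_le_sum (f := fun k => (x k : ℝ)) (fun k _ => (x k).2) (Finset.mem_univ n)
  have h2 : 0 ≤ z * (ρ : ℝ) := by positivity
  linarith

theorem ae_eq_zero_of_optimalShare (κ : Measure (Fin N → ℝ≥0)) [IsProbabilityMeasure κ] {ρ : ℝ≥0}
    {z : ℝ} (hz : 0 ≤ z) (hD : ∀ᵐ x ∂κ, 0 < z * ρ + ∑ n, (x n : ℝ)) {n : Fin N}
    (h0 : optimalShare κ ρ z n = 0) : ∀ᵐ x ∂κ, x n = 0 := by
  rw [optimalShare, integral_eq_zero_iff_of_nonneg (fun x => by positivity)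
    (integrable_share κ ρ hz n)] at h0
  filter_upwards [h0, hD] with x hx hDx
  rcases div_eq_zero_iff.1 hx with h | h
  · exact_mod_cast h
  · exact absurd h hDx.ne'

theorem one_sub_sum_optimalShare (κ : Measure (Fin N → ℝ≥0)) [IsProbabilityMeasure κ] {ρ : ℝ≥0}
    {z : ℝ} (hz : 0 ≤ z) (hD : ∀ᵐ x ∂κ, 0 < z * ρ + ∑ n, (x n : ℝ)) :
    1 - ∑ n, optimalShare κ ρ z n = ∫ x, z * ρ / (z * ρ + ∑ n, (x n : ℝ)) ∂κ := by
  have hint := fun n => integrable_share κ ρ hz n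
  unfold optimalShare
  rw [← integral_finsetSum _ fun n _ => hint n]
  have h1 : (1 : ℝ) = ∫ _, (1 : ℝ) ∂κ := by simp
  rw [h1, ← integral_sub (integrable_const _) (integrable_finsetSum _ fun n _ => hint n)]
  refine integral_congr_ae ?_
  filter_upwards [hD] with x hx
  rw [← Finset.sum_div, eq_div_iff hx.ne', sub_mul, div_mul_cancel₀ _ hx.ne']
  ring

/-- Either the budget left in the bank account is given by the equation that defines `ζ`, or
everything is invested in the assets. -/
theorem optimal_cash (κ : Measure (Fin N → ℝ≥0)) [IsProbabilityMeasure κ] {ρ : ℝ≥0} {c : ℝ}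
    (hc : 0 < c) (hpos : ∀ᵐ x ∂κ, 0 < ρ + ∑ n, x n) :
    c * ρ * (1 - ∑ n, optimalShare κ ρ (zeta κ ρ c) n) = zeta κ ρ c * ρ ∧
    ∀ s ≤ (1 : ℝ), (∑ n, optimalShare κ ρ (zeta κ ρ c) n - s) *
      ∫ x, c * ρ / (zeta κ ρ c * ρ + ∑ n, (x n : ℝ)) ∂κ ≤
      ∑ n, optimalShare κ ρ (zeta κ ρ c) n - s := by
  have hD := ae_pos_zeta κ hc hpos
  have hz := zeta_nonneg κ ρ c
  have h1 := one_sub_sum_optimalShare κ hz hD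
  have hI := integral_cash_zeta κ hc hpos
  by_cases h : InGamma κ ρ c
  · rw [(zeta_spec κ h).2, ENNReal.toReal_one] at hI
    refine ⟨?_, fun s _ => by rw [hI, mul_one]⟩
    have h2 : ∫ x, zeta κ ρ c * ρ / (zeta κ ρ c * ρ + ∑ n, (x n : ℝ)) ∂κ =
        zeta κ ρ c / c * ∫ x, c * ρ / (zeta κ ρ c * ρ + ∑ n, (x n : ℝ)) ∂κ := by
      rw [← integral_const_mul]
      refine integral_congr_ae (Eventually.of_forall fun x => ?_)
      change _ = zeta κ ρ c / c * (c * ρ / (zeta κ ρ c * ρ + ∑ n, (x n : ℝ)))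
      rw [← mul_div_assoc, ← mul_assoc, div_mul_cancel₀ _ hc.ne']
    rw [h1, h2, hI]
    field_simp
  -- Here nothing stays in the bank, so the proportions sum to 1. The factor of the integral is then
  -- nonnegative for `s ≤ 1`, and an integral at most 1 suffices.
  · have hz0 : zeta κ ρ c = 0 := by rw [zeta, dif_neg h]
    have h2 : 1 - ∑ n, optimalShare κ ρ (zeta κ ρ c) n = 0 := by
      rw [h1, hz0]
      simp
    refine ⟨by rw [h2, hz0]; simp, fun s hs => ?_⟩
    have hle : ∫ x, c * ρ / (zeta κ ρ c * ρ + ∑ n, (x n : ℝ)) ∂κ ≤ 1 := by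
      rw [hI]
      exact ENNReal.toReal_le_of_le_ofReal zero_le_one
        (by simpa using cashIntegral_zeta_le_one κ ρ c)
    exact mul_le_of_le_one_right (by linarith) hle

end Zeta

/-! ### One step of the wealth equation -/

section Step

variable {M N : ℕ}

/-- The proportion of the total wealth invested in the asset `n` by all investors together. -/
def meanShare (l : Fin M → Proportions N) (y : Fin M → ℝ) (n : Fin N) : ℝ :=
  (∑ k, (l k).1 n * y k) / ∑ k, y k

/-- The relative wealth of investor `i` after one step of the wealth equation. -/
def relStep (ρ : ℝ≥0) (x : Fin N → ℝ≥0) (l : Fin M → Proportions N) (y : Fin M → ℝ)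
    (i : Fin M) : ℝ :=
  wealthStep ρ x l y i / ∑ k, wealthStep ρ x l y k

theorem wealthStep_nonneg (ρ : ℝ≥0) (x : Fin N → ℝ≥0) (l : Fin M → Proportions N)
    {y : Fin M → ℝ} (hy : ∀ m, 0 ≤ y m) (m : Fin M) : 0 ≤ wealthStep ρ x l y m := by
  have h1 : 0 ≤ 1 - ∑ n, (l m).1 n := sub_nonneg.2 (l m).2.2
  have h2 : ∀ k n, 0 ≤ (l k).1 n * y k := fun k n => mul_nonneg ((l k).2.1 n) (hy k)
  refine add_nonneg (mul_nonneg (mul_nonneg ρ.2 h1) (hy m)) (Finset.sum_nonneg fun n _ => ?_)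
  exact mul_nonneg (div_nonneg (h2 m n) (Finset.sum_nonneg fun k _ => h2 k n)) (x n).2

theorem relStep_le_one (ρ : ℝ≥0) (x : Fin N → ℝ≥0) (l : Fin M → Proportions N)
    {y : Fin M → ℝ} (hy : ∀ m, 0 ≤ y m) (i : Fin M) : relStep ρ x l y i ≤ 1 :=
  div_le_one_of_le₀ (Finset.single_le_sum (fun k _ => wealthStep_nonneg ρ x l hy k)
    (Finset.mem_univ i)) (Finset.sum_nonneg fun k _ => wealthStep_nonneg ρ x l hy k)

theorem meanShare_nonneg (l : Fin M → Proportions N) {y : Fin M → ℝ} (hy : ∀ m, 0 ≤ y m)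
    (n : Fin N) : 0 ≤ meanShare l y n :=
  div_nonneg (Finset.sum_nonneg fun k _ => mul_nonneg ((l k).2.1 n) (hy k))
    (Finset.sum_nonneg fun k _ => hy k)

theorem sum_meanShare_le_one (l : Fin M → Proportions N) {y : Fin M → ℝ} (hy : ∀ m, 0 ≤ y m) :
    ∑ n, meanShare l y n ≤ 1 := by
  unfold meanShare
  rw [← Finset.sum_div]
  refine div_le_one_of_le₀ ?_ (Finset.sum_nonneg fun k _ => hy k)
  rw [Finset.sum_comm]
  refine Finset.sum_le_sum fun k _ => ?_
  rw [← Finset.sum_mul]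
  exact mul_le_of_le_one_left (hy k) (l k).2.2

/-- The payoff of an asset in which nobody invests would be lost, hence `hx`. An optimal investor
guarantees it almost surely, by `ae_eq_zero_of_optimalShare`. -/
theorem sum_wealthStep (ρ : ℝ≥0) (x : Fin N → ℝ≥0) (l : Fin M → Proportions N)
    {y : Fin M → ℝ} (hc : 0 < ∑ k, y k) (hx : ∀ n, meanShare l y n = 0 → x n = 0) :
    ∑ m, wealthStep ρ x l y m =
      (∑ k, y k) * ρ * (1 - ∑ n, meanShare l y n) + ∑ n, (x n : ℝ) := by
  unfold wealthStep
  rw [Finset.sum_add_distrib]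
  congr 1
  · have h1 : (∑ k, y k) * ∑ n, meanShare l y n = ∑ m, (∑ n, (l m).1 n) * y m := by
      simp only [meanShare, Finset.mul_sum, Finset.sum_mul, mul_div_cancel₀ _ hc.ne']
      rw [Finset.sum_comm]
    calc ∑ m, (ρ : ℝ) * (1 - ∑ n, (l m).1 n) * y m
        = ρ * (∑ m, y m - ∑ m, (∑ n, (l m).1 n) * y m) := by
          rw [← Finset.sum_sub_distrib, Finset.mul_sum]
          exact Finset.sum_congr rfl fun m _ => by ring
      _ = _ := by rw [← h1]; ring
  · rw [Finset.sum_comm]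
    refine Finset.sum_congr rfl fun n _ => ?_
    rw [← Finset.sum_mul, ← Finset.sum_div]
    rcases eq_or_ne (∑ k, (l k).1 n * y k) 0 with h | h
    · simp [hx n (by simp [meanShare, h])]
    · rw [div_self h, one_mul]

theorem wealthStep_eq_mul (ρ : ℝ≥0) (x : Fin N → ℝ≥0) (l : Fin M → Proportions N)
    {y : Fin M → ℝ} (hc : 0 < ∑ k, y k) (i : Fin M) :
    wealthStep ρ x l y i = y i / (∑ k, y k) *
      ((∑ k, y k) * ρ * (1 - ∑ n, (l i).1 n) +
        ∑ n, x n * ((l i).1 n / meanShare l y n)) := by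
  unfold wealthStep
  rw [mul_add]
  congr 1
  · field_simp
  · rw [Finset.mul_sum]
    refine Finset.sum_congr rfl fun n _ => ?_
    unfold meanShare
    rcases eq_or_ne (∑ k, (l k).1 n * y k) 0 with h | h
    · simp [h]
    · field_simp

theorem mul_le_meanShare (l : Fin M → Proportions N) {y : Fin M → ℝ} (hy : ∀ m, 0 ≤ y m)
    (i : Fin M) (n : Fin N) : (l i).1 n * y i / (∑ k, y k) ≤ meanShare l y n := by
  unfold meanShare
  refine div_le_div_of_nonneg_right ?_ (Finset.sum_nonneg fun k _ => hy k)
  exact Finset.single_le_sum (f := fun k => (l k).1 n * y k)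
    (fun k _ => mul_nonneg ((l k).2.1 n) (hy k)) (Finset.mem_univ i)

/-- The mean is the mixture of investor `i` and the representative of the others with weights `r`
and `1 - r`. If `r = 1` the others own nothing and both sides vanish. -/
theorem sub_meanShare (l : Fin M → Proportions N) {y : Fin M → ℝ} (hy : ∀ m, 0 ≤ y m)
    (hc : 0 < ∑ k, y k) (i : Fin M) (n : Fin N) :
    (l i).1 n - meanShare l y n = (1 - y i / ∑ k, y k) * ((l i).1 n -
      ∑ m ∈ Finset.univ.erase i, y m / (∑ k, y k) / (1 - y i / ∑ k, y k) * (l m).1 n) := by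
  have hsplit : meanShare l y n = y i / (∑ k, y k) * (l i).1 n +
      ∑ m ∈ Finset.univ.erase i, y m / (∑ k, y k) * (l m).1 n := by
    rw [Finset.add_sum_erase _ (fun m => y m / (∑ k, y k) * (l m).1 n) (Finset.mem_univ i),
      meanShare, Finset.sum_div]
    exact Finset.sum_congr rfl fun m _ => by ring
  rw [hsplit]
  rcases eq_or_ne (1 - y i / ∑ k, y k) 0 with h | h
  · have hi : y i = ∑ k, y k := by
      rw [sub_eq_zero, eq_comm, div_eq_one_iff_eq hc.ne'] at h
      exact h
    have hrest : ∑ m ∈ Finset.univ.erase i, y m = 0 := by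
      have := Finset.add_sum_erase Finset.univ y (Finset.mem_univ i)
      linarith
    have hz := (Finset.sum_eq_zero_iff_of_nonneg fun m _ => hy m).1 hrest
    have hsum0 : ∑ m ∈ Finset.univ.erase i, y m / (∑ k, y k) * (l m).1 n = 0 :=
      Finset.sum_eq_zero fun m hm => by rw [hz m hm]; simp
    rw [hsum0, h, zero_mul, add_zero, ← one_sub_mul, h, zero_mul]
  · rw [mul_sub, Finset.mul_sum]
    have : ∀ m, (1 - y i / ∑ k, y k) * (y m / (∑ k, y k) / (1 - y i / ∑ k, y k) * (l m).1 n) =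
        y m / (∑ k, y k) * (l m).1 n := fun m => by
      rw [← mul_assoc, mul_div_cancel₀ _ h]
    simp only [this]
    ring

/-- The pointwise lower bound for the growth of the logarithm of the relative wealth. -/
theorem neg_log_relStep_le {ρ : ℝ≥0} {x : Fin N → ℝ≥0} {l : Fin M → Proportions N}
    {y : Fin M → ℝ} {i : Fin M} {z : ℝ} (hy : ∀ m, 0 ≤ y m) (hyi : 0 < y i)
    (hc : 0 < ∑ k, y k) (hz : 0 ≤ z)
    (hcash : (∑ k, y k) * ρ * (1 - ∑ n, (l i).1 n) = z * ρ)
    (hD : 0 < z * ρ + ∑ n, (x n : ℝ)) (hx : ∀ n, (l i).1 n = 0 → x n = 0) :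
    0 < relStep ρ x l y i ∧
    -Real.log (relStep ρ x l y i) ≤ -Real.log (y i / ∑ k, y k) -
      ∑ n, (x n : ℝ) / (z * ρ + ∑ k, (x k : ℝ)) * Real.log ((l i).1 n / meanShare l y n) +
      (∑ n, (l i).1 n - ∑ n, meanShare l y n) *
        ((∑ k, y k) * ρ / (z * ρ + ∑ k, (x k : ℝ))) := by
  set c := ∑ k, y k
  set D := z * ρ + ∑ k, (x k : ℝ) with hDdef
  have hr : 0 < y i / c := div_pos hyi hc
  have hl : ∀ n, 0 ≤ (l i).1 n := (l i).2.1
  have hmean : ∀ n, meanShare l y n = 0 → (l i).1 n = 0 := by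
    intro n h0
    have h1 := mul_le_meanShare l hy i n
    rw [h0, mul_div_assoc] at h1
    exact le_antisymm (nonpos_of_mul_nonpos_left h1 hr) (hl n)
  set q : Fin N → ℝ := fun n => (l i).1 n / meanShare l y n with hqdef
  have hq : ∀ n, 0 ≤ q n := fun n => div_nonneg (hl n) (meanShare_nonneg l hy n)
  have hq0 : ∀ n, q n = 0 → x n = 0 := by
    intro n h
    rcases div_eq_zero_iff.1 h with h | h
    · exact hx n h
    · exact hx n (hmean n h)
  have hY := wealthStep_eq_mul ρ x l hc i
  have hW := sum_wealthStep ρ x l hc fun n h => hx n (hmean n h)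
  rw [hcash] at hY
  have hzρ : 0 ≤ z * (ρ : ℝ) := by positivity
  have hterm : ∀ n, 0 ≤ (x n : ℝ) * q n := fun n => mul_nonneg (x n).2 (hq n)
  have hA : 0 < z * ρ + ∑ n, (x n : ℝ) * q n := by
    by_contra! hn
    have hs : 0 ≤ ∑ n, (x n : ℝ) * q n := Finset.sum_nonneg fun n _ => hterm n
    have h0 : ∑ n, (x n : ℝ) * q n = 0 := by linarith
    have hall := (Finset.sum_eq_zero_iff_of_nonneg fun n _ => hterm n).1 h0
    have hx0 : ∑ n, (x n : ℝ) = 0 := Finset.sum_eq_zero fun n hn => by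
      rcases mul_eq_zero.1 (hall n hn) with h | h
      · exact h
      · simp [hq0 n h]
    linarith
  set A := z * ρ + ∑ n, (x n : ℝ) * q n with hAdef
  have hY' : wealthStep ρ x l y i = y i / c * A := hY
  have hYpos : 0 < wealthStep ρ x l y i := by rw [hY']; positivity
  have hWpos : 0 < ∑ m, wealthStep ρ x l y m := hYpos.trans_le
    (Finset.single_le_sum (fun k _ => wealthStep_nonneg ρ x l hy k) (Finset.mem_univ i))
  refine ⟨div_pos hYpos hWpos, ?_⟩
  set W := ∑ m, wealthStep ρ x l y m with hWdef
  have hlogs : Real.log (relStep ρ x l y i) =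
      Real.log (y i / c) + Real.log (A / D) - Real.log (W / D) := by
    rw [relStep, Real.log_div hYpos.ne' hWpos.ne', hY', Real.log_mul hr.ne' hA.ne',
      Real.log_div hA.ne' hD.ne', Real.log_div hWpos.ne' hD.ne']
    ring
  have hAD : z * ρ / D + ∑ n, (x n : ℝ) / D * q n = A / D := by
    rw [hAdef, add_div, Finset.sum_div]
    congr 1
    exact Finset.sum_congr rfl fun n _ => by ring
  -- By the choice of `D` the weights sum to 1, and by `hcash` the bank term of investor `i` is
  -- exactly `z * ρ`.
  have hJ := sum_mul_log_le_log_add_sum (p₀ := z * ρ / D) (p := fun n => (x n : ℝ) / D) (q := q)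
    (by positivity) (fun n => by positivity)
    (by rw [← Finset.sum_div, ← add_div, ← hDdef, div_self hD.ne']) hq
    (fun n h => by simp [hq0 n h])
    (by rw [hAD]; positivity)
  rw [hAD] at hJ
  have hu : Real.log (W / D) ≤ (∑ n, (l i).1 n - ∑ n, meanShare l y n) * (c * ρ / D) := by
    refine (Real.log_le_sub_one_of_pos (div_pos hWpos hD)).trans (le_of_eq ?_)
    rw [hW]
    have : c * ρ * (1 - ∑ n, meanShare l y n) + ∑ n, (x n : ℝ) =
        D + (∑ n, (l i).1 n - ∑ n, meanShare l y n) * (c * ρ) := by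
      rw [hDdef, ← hcash]
      ring
    rw [this, add_div, div_self hD.ne']
    ring
  rw [hlogs]
  linarith

/-- If investor `i` invests optimally, then the expected decrease of `-log` of the relative wealth
of this investor over one step is at least a quarter of the squared distance between the
proportions of investor `i` and those of the other investors, weighted by the squared
relative wealth of the latter. -/
theorem lintegral_neg_log_relStep (κ : Measure (Fin N → ℝ≥0)) [IsProbabilityMeasure κ] {ρ : ℝ≥0}
    (hpos : ∀ᵐ x ∂κ, 0 < ρ + ∑ n, x n) {l : Fin M → Proportions N} {y : Fin M → ℝ} {i : Fin M}
    (hy : ∀ m, 0 ≤ y m) (hyi : 0 < y i)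
    (hl : ∀ n, (l i).1 n = optimalShare κ ρ (zeta κ ρ (∑ k, y k)) n) :
    (∀ᵐ x ∂κ, 0 < relStep ρ x l y i) ∧
    ∫⁻ x, ENNReal.ofReal (-Real.log (relStep ρ x l y i)) ∂κ +
      ENNReal.ofReal ((1 - y i / ∑ k, y k) ^ 2 / 4 * ∑ n, ((l i).1 n -
        ∑ m ∈ Finset.univ.erase i, y m / (∑ k, y k) / (1 - y i / ∑ k, y k) * (l m).1 n) ^ 2) ≤
      ENNReal.ofReal (-Real.log (y i / ∑ k, y k)) := by
  have hc : 0 < ∑ k, y k :=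
    hyi.trans_le (Finset.single_le_sum (fun k _ => hy k) (Finset.mem_univ i))
  have hδ : (1 - y i / ∑ k, y k) ^ 2 / 4 * ∑ n, ((l i).1 n - ∑ m ∈ Finset.univ.erase i,
      y m / (∑ k, y k) / (1 - y i / ∑ k, y k) * (l m).1 n) ^ 2 =
      ∑ n, ((l i).1 n - meanShare l y n) ^ 2 / 4 := by
    rw [Finset.mul_sum]
    refine Finset.sum_congr rfl fun n _ => ?_
    rw [sub_meanShare l hy hc i n]
    ring
  rw [hδ]
  obtain ⟨hcash, hI⟩ := optimal_cash κ hc hpos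
  have hD := ae_pos_zeta κ hc hpos
  have hcint := integrable_cash_zeta κ hc hpos
  set c := ∑ k, y k
  have hz := zeta_nonneg κ ρ c
  set z := zeta κ ρ c
  have hsum : ∑ n, optimalShare κ ρ z n = ∑ n, (l i).1 n :=
    Finset.sum_congr rfl fun n _ => (hl n).symm
  rw [hsum] at hcash hI
  have hx0 : ∀ᵐ x ∂κ, ∀ n, (l i).1 n = 0 → x n = 0 := by
    refine ae_all_iff.2 fun n => ?_
    by_cases h0 : (l i).1 n = 0
    · filter_upwards [ae_eq_zero_of_optimalShare κ hz hD ((hl n).symm.trans h0)] with x hx _ using hx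
    · exact Eventually.of_forall fun x h => absurd h h0
  have hpt : ∀ᵐ x ∂κ, 0 < relStep ρ x l y i ∧
      -Real.log (relStep ρ x l y i) ≤ -Real.log (y i / c) -
        ∑ n, (x n : ℝ) / (z * ρ + ∑ k, (x k : ℝ)) * Real.log ((l i).1 n / meanShare l y n) +
        (∑ n, (l i).1 n - ∑ n, meanShare l y n) * (c * ρ / (z * ρ + ∑ k, (x k : ℝ))) := by
    filter_upwards [hD, hx0] with x hDx hx
    exact neg_log_relStep_le hy hyi hc hz hcash hDx hx
  refine ⟨hpt.mono fun x hx => hx.1, ?_⟩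
  set h : (Fin N → ℝ≥0) → ℝ := fun x => -Real.log (y i / c) -
        ∑ n, (x n : ℝ) / (z * ρ + ∑ k, (x k : ℝ)) * Real.log ((l i).1 n / meanShare l y n) +
        (∑ n, (l i).1 n - ∑ n, meanShare l y n) * (c * ρ / (z * ρ + ∑ k, (x k : ℝ))) with hdef
  have hshare := fun n => (integrable_share κ ρ hz n).mul_const
    (Real.log ((l i).1 n / meanShare l y n))
  have hs1 : Integrable (fun x : Fin N → ℝ≥0 => ∑ n, (x n : ℝ) / (z * ρ + ∑ k, (x k : ℝ)) *
      Real.log ((l i).1 n / meanShare l y n)) κ := integrable_finsetSum _ fun n _ => hshare n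
  have hs2 : Integrable (fun x : Fin N → ℝ≥0 => -Real.log (y i / c) -
      ∑ n, (x n : ℝ) / (z * ρ + ∑ k, (x k : ℝ)) *
      Real.log ((l i).1 n / meanShare l y n)) κ := (integrable_const _).sub hs1
  have hhint : Integrable h κ := hs2.add (hcint.const_mul _)
  have hval : ∫ x, h x ∂κ = -Real.log (y i / c) -
      ∑ n, (l i).1 n * Real.log ((l i).1 n / meanShare l y n) +
      (∑ n, (l i).1 n - ∑ n, meanShare l y n) *
        ∫ x, c * ρ / (z * ρ + ∑ k, (x k : ℝ)) ∂κ := by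
    rw [hdef, integral_add hs2 (hcint.const_mul _), integral_sub (integrable_const _) hs1,
      integral_finsetSum _ fun n _ => hshare n, integral_const_mul]
    simp only [integral_mul_const, integral_const, probReal_univ, one_smul]
    congr 2
    exact Finset.sum_congr rfl fun n _ => by rw [hl n]; rfl
  -- The bound dominates `-log` of a number in `(0, 1]`, so its lower integral equals its Bochner
  -- integral.
  have hnn : ∀ᵐ x ∂κ, 0 ≤ h x := by
    filter_upwards [hpt] with x hx
    refine le_trans ?_ hx.2
    rw [neg_nonneg]
    exact Real.log_nonpos hx.1.le (relStep_le_one ρ x l hy i)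
  have hmean1 := sum_meanShare_le_one l hy
  have hkl : ∑ n, ((l i).1 n - meanShare l y n) ^ 2 / 4 ≤
      ∑ n, (l i).1 n * Real.log ((l i).1 n / meanShare l y n) -
        (∑ n, (l i).1 n - ∑ n, meanShare l y n) := by
    rw [← Finset.sum_sub_distrib, ← Finset.sum_sub_distrib]
    refine Finset.sum_le_sum fun n _ => ?_
    have h1 : (l i).1 n ≤ 1 := (Finset.single_le_sum (fun k _ => (l i).2.1 k)
      (Finset.mem_univ n)).trans (l i).2.2
    have h2 : meanShare l y n ≤ 1 := (Finset.single_le_sum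
      (fun k _ => meanShare_nonneg l hy k) (Finset.mem_univ n)).trans hmean1
    have := sq_sub_div_four_le_mul_log ((l i).2.1 n) h1 (meanShare_nonneg l hy n) h2 (by
      intro h0
      have h3 := mul_le_meanShare l hy i n
      rw [h0, mul_div_assoc] at h3
      exact le_antisymm (nonpos_of_mul_nonpos_left h3 (div_pos hyi hc)) ((l i).2.1 n))
    linarith
  have hIs := hI _ hmean1
  have hint0 : 0 ≤ ∫ x, h x ∂κ := integral_nonneg_of_ae hnn
  calc _ ≤ ∫⁻ x, ENNReal.ofReal (h x) ∂κ +
        ENNReal.ofReal (∑ n, ((l i).1 n - meanShare l y n) ^ 2 / 4) := by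
        gcongr ?_ + _
        exact lintegral_mono_ae (hpt.mono fun x hx => ENNReal.ofReal_le_ofReal hx.2)
    _ = ENNReal.ofReal (∫ x, h x ∂κ + ∑ n, ((l i).1 n - meanShare l y n) ^ 2 / 4) := by
        rw [← ofReal_integral_eq_lintegral_ofReal hhint hnn, ENNReal.ofReal_add hint0
          (Finset.sum_nonneg fun n _ => by positivity)]
    _ ≤ _ := ENNReal.ofReal_le_ofReal (by rw [hval]; linarith)

end Step

/-! ### Integration against a regular conditional distribution -/

section Disintegration

variable {Ω E : Type*} {m mΩ : MeasurableSpace Ω} {mE : MeasurableSpace E} {P : Measure Ω}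
  [IsProbabilityMeasure P]

/-- On a rectangle `A ×ˢ B` both sides equal `P (A ∩ X ⁻¹' B)`, by the defining property of
conditional expectation. The measure is trimmed because `κ` is only `m`-measurable. -/
theorem trim_compProd_eq_map (hm : m ≤ mΩ) (κ : Kernel[m] Ω E)
    (hκ : ∀ ω, IsProbabilityMeasure (κ ω)) {X : Ω → E} (hX : Measurable X)
    (hver : ∀ A, MeasurableSet A → (fun ω => (κ ω).real A) =ᵐ[P] P⟦X ⁻¹' A | m⟧) :
    (P.trim hm) ⊗ₘ κ = @Measure.map Ω (Ω × E) mΩ (m.prod mE) (fun ω => (ω, X ω)) P := by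
  have : IsMarkovKernel κ := ⟨hκ⟩
  have : IsFiniteMeasure (P.trim hm) := isFiniteMeasure_trim hm
  have hpair : @Measurable Ω (Ω × E) mΩ (m.prod mE) (fun ω => (ω, X ω)) :=
    (measurable_id'' hm).prodMk hX
  refine Measure.ext_prod fun {A B} hA hB => ?_
  rw [Measure.compProd_apply_prod hA hB, Measure.map_apply hpair (hA.prod hB)]
  have hκB : Measurable[m] fun ω => κ ω B := Kernel.measurable_coe κ hB
  have hind : Integrable ((X ⁻¹' B).indicator fun _ => (1 : ℝ)) P :=
    (integrable_const _).indicator (hX hB)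
  have hset := setIntegral_condExp hm hind hA
  rw [restrict_trim hm P hA, lintegral_trim hm hκB]
  have h1 : ∫⁻ ω in A, κ ω B ∂P = ENNReal.ofReal (∫ ω in A, (κ ω).real B ∂P) := by
    rw [ofReal_integral_eq_lintegral_ofReal]
    · exact lintegral_congr fun ω => by simp [Measure.real]
    · refine Integrable.of_bound (C := 1)
        (hκB.ennreal_toReal.mono hm le_rfl).aestronglyMeasurable (Eventually.of_forall fun ω => ?_)
      rw [Real.norm_of_nonneg measureReal_nonneg]
      exact measureReal_le_one
    · exact Eventually.of_forall fun ω => measureReal_nonneg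
  rw [h1, setIntegral_congr_ae (hm A hA) ((hver B hB).mono fun ω h _ => h), hset,
    integral_indicator_const _ (hX hB), smul_eq_mul, mul_one, measureReal_restrict_apply (hX hB),
    ofReal_measureReal]
  congr 1
  ext ω
  exact and_comm

theorem lintegral_disintegration (hm : m ≤ mΩ) (κ : Kernel[m] Ω E)
    (hκ : ∀ ω, IsProbabilityMeasure (κ ω)) {X : Ω → E} (hX : Measurable X)
    (hver : ∀ A, MeasurableSet A → (fun ω => (κ ω).real A) =ᵐ[P] P⟦X ⁻¹' A | m⟧)
    {f : Ω × E → ℝ≥0∞} (hf : Measurable[m.prod mE] f) :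
    ∫⁻ ω, f (ω, X ω) ∂P = ∫⁻ ω, ∫⁻ x, f (ω, x) ∂(κ ω) ∂P := by
  have : IsMarkovKernel κ := ⟨hκ⟩
  have : IsFiniteMeasure (P.trim hm) := isFiniteMeasure_trim hm
  have hpair : @Measurable Ω (Ω × E) mΩ (m.prod mE) (fun ω => (ω, X ω)) :=
    (measurable_id'' hm).prodMk hX
  rw [← @lintegral_map Ω (Ω × E) mΩ (m.prod mE) P f _ hf hpair, ← trim_compProd_eq_map hm κ hκ hX hver,
    Measure.lintegral_compProd hf, lintegral_trim hm (hf.lintegral_kernel_prod_right' (κ := κ))]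

theorem ae_disintegration (hm : m ≤ mΩ) (κ : Kernel[m] Ω E)
    (hκ : ∀ ω, IsProbabilityMeasure (κ ω)) {X : Ω → E} (hX : Measurable X)
    (hver : ∀ A, MeasurableSet A → (fun ω => (κ ω).real A) =ᵐ[P] P⟦X ⁻¹' A | m⟧)
    {p : Ω × E → Prop} (hp : MeasurableSet[m.prod mE] {q | p q}) :
    (∀ᵐ ω ∂P, p (ω, X ω)) ↔ ∀ᵐ ω ∂P, ∀ᵐ x ∂(κ ω), p (ω, x) := by
  have : IsMarkovKernel κ := ⟨hκ⟩
  have : IsFiniteMeasure (P.trim hm) := isFiniteMeasure_trim hm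
  have hpair : @Measurable Ω (Ω × E) mΩ (m.prod mE) (fun ω => (ω, X ω)) :=
    (measurable_id'' hm).prodMk hX
  have hs : MeasurableSet[m] {ω | ∀ᵐ x ∂(κ ω), p (ω, x)} := by
    have h := Kernel.measurable_kernel_prodMk_left (κ := κ) hp.compl
    exact h (measurableSet_singleton 0)
  rw [← @ae_map_iff Ω (Ω × E) mΩ (m.prod mE) P _
      (@Measurable.aemeasurable Ω (Ω × E) mΩ (m.prod mE) _ P hpair) _ hp, ← trim_compProd_eq_map hm κ hκ hX hver,
    Measure.ae_compProd_iff hp]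
  refine ⟨ae_of_ae_trim hm, fun h => ?_⟩
  -- The exceptional set is `m`-measurable, so being null for `P` makes it null for the trimmed
  -- measure.
  exact (trim_measurableSet_eq hm hs.compl).trans h

end Disintegration

/-! ### Measurability and recursion of the realized quantities -/

section Realized

variable {Ω : Type*} {mΩ : MeasurableSpace Ω} {P : Measure Ω} {ℱ : Filtration ℕ mΩ} {M N : ℕ}

/-- The moves `λ_{t+1}(ω)` of all investors realized in the round `t + 1`. -/
def realizedMove (L : Fin M → Strategy ℱ M N) (y₀ : Fin M → ℝ≥0) (t : ℕ) (ω : Ω) :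
    Fin M → Proportions N :=
  fun m => (L m).act t ω (y₀, realizedMoves L y₀ ω t)

theorem measurable_realizedMove_of (L : Fin M → Strategy ℱ M N) (y₀ : Fin M → ℝ≥0) (t : ℕ)
    (h : Measurable[ℱ t] fun ω => realizedMoves L y₀ ω t) :
    Measurable[ℱ t] (realizedMove L y₀ t) := by
  have hact := fun m => (L m).measurable_act t
  let _ : MeasurableSpace Ω := ℱ t
  refine measurable_pi_iff.2 fun m => ?_
  exact (hact m).comp (measurable_id.prodMk (measurable_const.prodMk h))

theorem measurable_realizedMoves (L : Fin M → Strategy ℱ M N) (y₀ : Fin M → ℝ≥0) (t : ℕ) :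
    Measurable[ℱ t] fun ω => realizedMoves L y₀ ω t := by
  induction t with
  | zero => exact measurable_const
  | succ t ih =>
    have hmove := (measurable_realizedMove_of L y₀ t ih).mono (ℱ.mono (Nat.le_succ t)) le_rfl
    have ih' := ih.mono (ℱ.mono (Nat.le_succ t)) le_rfl
    clear ih
    let _ : MeasurableSpace Ω := ℱ (t + 1)
    refine measurable_pi_iff.2 fun s => ?_
    induction s using Fin.lastCases with
    | last =>
      simp only [realizedMoves, Fin.snoc_last]
      exact hmove
    | cast s =>
      simpa only [realizedMoves, Fin.snoc_castSucc] using measurable_pi_iff.1 ih' s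

theorem measurable_realizedMove (L : Fin M → Strategy ℱ M N) (y₀ : Fin M → ℝ≥0) (t : ℕ) :
    Measurable[ℱ t] (realizedMove L y₀ t) :=
  measurable_realizedMove_of L y₀ t (measurable_realizedMoves L y₀ t)

theorem measurable_realization (L : Fin M → Strategy ℱ M N) (y₀ : Fin M → ℝ≥0) (t : ℕ)
    (m : Fin M) (n : Fin N) : Measurable[ℱ t] fun ω => realization L y₀ t ω m n := by
  have h := measurable_realizedMove L y₀ t
  let _ : MeasurableSpace Ω := ℱ t
  exact (measurable_pi_apply n).comp (measurable_subtype_coe.comp ((measurable_pi_apply m).comp h))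

theorem Market.measurable_wealth (S : Market P ℱ N) (L : Fin M → Strategy ℱ M N)
    (y₀ : Fin M → ℝ≥0) (t : ℕ) (m : Fin M) : Measurable[ℱ t] fun ω => S.wealth L y₀ t ω m := by
  have h := measurable_realizedMoves L y₀ t
  have hW := S.measurable_wealthOf (M := M) t m
  let _ : MeasurableSpace Ω := ℱ t
  exact hW.comp (measurable_id.prodMk (measurable_const.prodMk h))

theorem Market.measurable_relWealth (S : Market P ℱ N) (L : Fin M → Strategy ℱ M N)
    (y₀ : Fin M → ℝ≥0) (t : ℕ) (m : Fin M) :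
    Measurable[ℱ t] fun ω => S.relWealth L y₀ t ω m := by
  have h := S.measurable_wealth L y₀ t
  let _ : MeasurableSpace Ω := ℱ t
  exact (h m).div (Finset.measurable_sum _ fun k _ => h k)

theorem Market.distance_sq (S : Market P ℱ N) (L : Fin M → Strategy ℱ M N)
    (y₀ : Fin M → ℝ≥0) (i : Fin M) (t : ℕ) (ω : Ω) : S.distance L y₀ i t ω ^ 2 =
      ∑ n, (realization L y₀ t ω i n - S.representative L y₀ i t ω n) ^ 2 := by
  simp [Market.distance, EuclideanSpace.norm_sq_eq]

theorem Market.measurable_distance_sq (S : Market P ℱ N) (L : Fin M → Strategy ℱ M N)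
    (y₀ : Fin M → ℝ≥0) (i : Fin M) (t : ℕ) :
    Measurable[ℱ t] fun ω => S.distance L y₀ i t ω ^ 2 := by
  have hr := S.measurable_relWealth L y₀ t
  have hl := measurable_realization L y₀ t
  let _ : MeasurableSpace Ω := ℱ t
  simp only [Market.distance_sq, Market.representative]
  exact Finset.measurable_sum _ fun n _ => ((hl i n).sub (Finset.measurable_sum _ fun m _ =>
    ((hr m).div (measurable_const.sub (hr i))).mul (hl m n))).pow_const 2

theorem Market.measurable_weighted_distance_sq (S : Market P ℱ N) (L : Fin M → Strategy ℱ M N)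
    (y₀ : Fin M → ℝ≥0) (i : Fin M) (t : ℕ) : Measurable fun ω => ENNReal.ofReal
      ((1 - S.relWealth L y₀ t ω i) ^ 2 / 4 * S.distance L y₀ i t ω ^ 2) :=
  ((((measurable_const.sub ((S.measurable_relWealth L y₀ t i).mono (ℱ.le t) le_rfl)).pow_const
    2).div_const 4).mul ((S.measurable_distance_sq L y₀ i t).mono (ℱ.le t) le_rfl)).ennreal_ofReal

theorem Market.wealth_succ (S : Market P ℱ N) (L : Fin M → Strategy ℱ M N)
    (y₀ : Fin M → ℝ≥0) (t : ℕ) (ω : Ω) (m : Fin M) : S.wealth L y₀ (t + 1) ω m =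
      wealthStep (S.ρ (t + 1) ω) (S.X (t + 1) ω) (realizedMove L y₀ t ω) (S.wealth L y₀ t ω) m := by
  simp only [Market.wealth, Market.wealthOf, realizedMoves, Fin.snoc_last, Fin.init_snoc]
  rfl

theorem Market.relWealth_succ (S : Market P ℱ N) (L : Fin M → Strategy ℱ M N)
    (y₀ : Fin M → ℝ≥0) (t : ℕ) (ω : Ω) (m : Fin M) : S.relWealth L y₀ (t + 1) ω m =
      relStep (S.ρ (t + 1) ω) (S.X (t + 1) ω) (realizedMove L y₀ t ω) (S.wealth L y₀ t ω) m := by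
  simp only [Market.relWealth, relStep, Market.wealth_succ]

theorem Market.wealth_nonneg (S : Market P ℱ N) (L : Fin M → Strategy ℱ M N)
    (y₀ : Fin M → ℝ≥0) (t : ℕ) (ω : Ω) (m : Fin M) : 0 ≤ S.wealth L y₀ t ω m := by
  induction t generalizing m with
  | zero => exact (y₀ m).2
  | succ t ih =>
    rw [S.wealth_succ]
    exact wealthStep_nonneg _ _ _ ih m

theorem Market.relWealth_nonneg (S : Market P ℱ N) (L : Fin M → Strategy ℱ M N)
    (y₀ : Fin M → ℝ≥0) (t : ℕ) (ω : Ω) (m : Fin M) : 0 ≤ S.relWealth L y₀ t ω m :=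
  div_nonneg (S.wealth_nonneg L y₀ t ω m)
    (Finset.sum_nonneg fun k _ => S.wealth_nonneg L y₀ t ω k)

theorem Market.relWealth_le_one (S : Market P ℱ N) (L : Fin M → Strategy ℱ M N)
    (y₀ : Fin M → ℝ≥0) (t : ℕ) (ω : Ω) (m : Fin M) : S.relWealth L y₀ t ω m ≤ 1 :=
  div_le_one_of_le₀ (Finset.single_le_sum (fun k _ => S.wealth_nonneg L y₀ t ω k)
    (Finset.mem_univ m)) (Finset.sum_nonneg fun k _ => S.wealth_nonneg L y₀ t ω k)

/-- The payoff stays a free variable so that the past is only `ℱ t`-measurable, as disintegration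
requires. -/
theorem Market.measurable_relStep (S : Market P ℱ N) (L : Fin M → Strategy ℱ M N)
    (y₀ : Fin M → ℝ≥0) (t : ℕ) (i : Fin M) :
    Measurable[(ℱ t).prod (inferInstance : MeasurableSpace (Fin N → ℝ≥0))]
      fun p : Ω × (Fin N → ℝ≥0) =>
        relStep (S.ρ (t + 1) p.1) p.2 (realizedMove L y₀ t p.1) (S.wealth L y₀ t p.1) i := by
  have hl := measurable_realization L y₀ t
  have hW := S.measurable_wealth L y₀ t
  have hρ := S.measurable_ρ t
  let _ : MeasurableSpace Ω := ℱ t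
  have hl' : ∀ k n, Measurable fun p : Ω × (Fin N → ℝ≥0) => (realizedMove L y₀ t p.1 k).1 n :=
    fun k n => (hl k n).comp measurable_fst
  have hW' : ∀ k, Measurable fun p : Ω × (Fin N → ℝ≥0) => S.wealth L y₀ t p.1 k :=
    fun k => (hW k).comp measurable_fst
  have hρ' : Measurable fun p : Ω × (Fin N → ℝ≥0) => (S.ρ (t + 1) p.1 : ℝ) :=
    measurable_coe_nnreal_real.comp (hρ.comp measurable_fst)
  have hstep : ∀ m, Measurable fun p : Ω × (Fin N → ℝ≥0) =>
      wealthStep (S.ρ (t + 1) p.1) p.2 (realizedMove L y₀ t p.1) (S.wealth L y₀ t p.1) m := by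
    intro m
    unfold wealthStep
    exact ((hρ'.mul (measurable_const.sub (Finset.measurable_sum _ fun n _ => hl' m n))).mul
      (hW' m)).add (Finset.measurable_sum _ fun n _ => (((hl' m n).mul (hW' m)).div
        (Finset.measurable_sum _ fun k _ => (hl' k n).mul (hW' k))).mul (by fun_prop))
  exact (hstep i).div (Finset.measurable_sum _ fun k _ => hstep k)

end Realized

/-! ### The supermartingale inequality -/

section Growth

variable {Ω : Type*} {mΩ : MeasurableSpace Ω} {P : Measure Ω} [IsProbabilityMeasure P]
  {ℱ : Filtration ℕ mΩ} {M N : ℕ}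

theorem PayoffKernel.ae_pos {S : Market P ℱ N} (K : PayoffKernel S) (t : ℕ) :
    ∀ᵐ ω ∂P, ∀ᵐ x ∂(K.kernel t ω), 0 < S.ρ (t + 1) ω + ∑ n, x n := by
  refine (ae_disintegration (ℱ.le t) (K.kernel t) (K.prob t)
    ((S.measurable_X t).mono (ℱ.le _) le_rfl) (K.version t)
    (p := fun q => 0 < S.ρ (t + 1) q.1 + ∑ n, q.2 n) ?_).1 (S.pos t)
  have hρ := S.measurable_ρ t
  let _ : MeasurableSpace Ω := ℱ t
  exact measurableSet_lt measurable_const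
    ((hρ.comp measurable_fst).add (Finset.measurable_sum _ fun n _ => by fun_prop))

/-- The one-step estimate for an optimal investor, conditionally on the past. -/
theorem Market.ae_lintegral_neg_log_relStep (S : Market P ℱ N) (K : PayoffKernel S)
    (L : Fin M → Strategy ℱ M N) (y₀ : Fin M → ℝ≥0) {i : Fin M}
    (hL : L i = optimalStrategy M S K) (t : ℕ) : ∀ᵐ ω ∂P, 0 < S.relWealth L y₀ t ω i →
      (∀ᵐ x ∂(K.kernel t ω), 0 <
        relStep (S.ρ (t + 1) ω) x (realizedMove L y₀ t ω) (S.wealth L y₀ t ω) i) ∧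
      ∫⁻ x, ENNReal.ofReal (-Real.log (relStep (S.ρ (t + 1) ω) x (realizedMove L y₀ t ω)
        (S.wealth L y₀ t ω) i)) ∂(K.kernel t ω) +
      ENNReal.ofReal ((1 - S.relWealth L y₀ t ω i) ^ 2 / 4 * S.distance L y₀ i t ω ^ 2) ≤
      ENNReal.ofReal (-Real.log (S.relWealth L y₀ t ω i)) := by
  filter_upwards [K.ae_pos t] with ω hω hr
  have := K.prob t ω
  have hy := S.wealth_nonneg L y₀ t ω
  have hyi : 0 < S.wealth L y₀ t ω i := by
    refine lt_of_le_of_ne (hy i) fun h => ?_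
    rw [Market.relWealth, ← h, zero_div] at hr
    exact lt_irrefl _ hr
  have hmove : ∀ n, (realizedMove L y₀ t ω i).1 n = optimalShare (K.kernel t ω) (S.ρ (t + 1) ω)
      (zeta (K.kernel t ω) (S.ρ (t + 1) ω) (∑ k, S.wealth L y₀ t ω k)) n := by
    intro n
    -- Along the realized history, `totalWealthOf` unfolds to the sum of the realized wealths.
    simp only [realizedMove, hL]
    rfl
  rw [S.distance_sq]
  exact lintegral_neg_log_relStep (K.kernel t ω) hω hy hyi hmove

/-- The one-step estimate applies only at positive relative wealth, and the convention `log 0 = 0`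
would otherwise hide ruin; positivity propagates through the kernel. -/
theorem Market.ae_relWealth_pos (S : Market P ℱ N) (K : PayoffKernel S)
    (L : Fin M → Strategy ℱ M N) {y₀ : Fin M → ℝ≥0} {i : Fin M} (hy₀ : 0 < y₀ i)
    (hL : L i = optimalStrategy M S K) (t : ℕ) : ∀ᵐ ω ∂P, 0 < S.relWealth L y₀ t ω i := by
  induction t with
  | zero =>
    refine Eventually.of_forall fun ω => ?_
    have h0 : 0 < S.wealth L y₀ 0 ω i := by
      change (0 : ℝ) < y₀ i
      exact_mod_cast hy₀
    exact div_pos h0 (h0.trans_le (Finset.single_le_sum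
      (fun k _ => S.wealth_nonneg L y₀ 0 ω k) (Finset.mem_univ i)))
  | succ t ih =>
    have h := (ae_disintegration (ℱ.le t) (K.kernel t) (K.prob t)
      ((S.measurable_X t).mono (ℱ.le _) le_rfl) (K.version t)
      (p := fun q => 0 < relStep (S.ρ (t + 1) q.1) q.2 (realizedMove L y₀ t q.1)
        (S.wealth L y₀ t q.1) i)
      (S.measurable_relStep L y₀ t i measurableSet_Ioi)).2 (by
        filter_upwards [S.ae_lintegral_neg_log_relStep K L y₀ hL t, ih] with ω hω hr
        exact (hω hr).1)
    filter_upwards [h] with ω hω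
    rwa [S.relWealth_succ]

/-- The conditional estimate integrated over events of the past. In `ℝ≥0∞` it needs no
integrability, which is deduced from it afterwards. -/
theorem Market.setLIntegral_neg_log_relWealth (S : Market P ℱ N) (K : PayoffKernel S)
    (L : Fin M → Strategy ℱ M N) {y₀ : Fin M → ℝ≥0} {i : Fin M} (hy₀ : 0 < y₀ i)
    (hL : L i = optimalStrategy M S K) (t : ℕ) {A : Set Ω} (hA : MeasurableSet[ℱ t] A) :
    ∫⁻ ω in A, ENNReal.ofReal (-Real.log (S.relWealth L y₀ (t + 1) ω i)) ∂P +
      ∫⁻ ω in A, ENNReal.ofReal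
        ((1 - S.relWealth L y₀ t ω i) ^ 2 / 4 * S.distance L y₀ i t ω ^ 2) ∂P ≤
      ∫⁻ ω in A, ENNReal.ofReal (-Real.log (S.relWealth L y₀ t ω i)) ∂P := by
  have hAm := ℱ.le t A hA
  set f : Ω × (Fin N → ℝ≥0) → ℝ≥0∞ := fun q => ENNReal.ofReal (-Real.log
    (relStep (S.ρ (t + 1) q.1) q.2 (realizedMove L y₀ t q.1) (S.wealth L y₀ t q.1) i)) with hf
  have hfm : Measurable[(ℱ t).prod inferInstance] f :=
    (Real.measurable_log.comp (S.measurable_relStep L y₀ t i)).neg.ennreal_ofReal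
  have hA' : MeasurableSet[(ℱ t).prod inferInstance] (A ×ˢ (Set.univ : Set (Fin N → ℝ≥0))) := by
    let _ : MeasurableSpace Ω := ℱ t
    exact hA.prod MeasurableSet.univ
  have hdis := lintegral_disintegration (ℱ.le t) (K.kernel t) (K.prob t)
    ((S.measurable_X t).mono (ℱ.le _) le_rfl) (K.version t) (hfm.indicator hA')
  have hleft : ∀ ω x, (A ×ˢ (Set.univ : Set (Fin N → ℝ≥0))).indicator f (ω, x) =
      A.indicator (fun ω => f (ω, x)) ω := by
    intro ω x
    by_cases h : ω ∈ A <;> simp [h]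
  have hnext : ∫⁻ ω in A, ENNReal.ofReal (-Real.log (S.relWealth L y₀ (t + 1) ω i)) ∂P =
      ∫⁻ ω in A, ∫⁻ x, f (ω, x) ∂(K.kernel t ω) ∂P := by
    rw [← lintegral_indicator hAm, ← lintegral_indicator hAm]
    calc _ = ∫⁻ ω, (A ×ˢ (Set.univ : Set (Fin N → ℝ≥0))).indicator f (ω, S.X (t + 1) ω) ∂P := by
          refine lintegral_congr fun ω => ?_
          rw [hleft]
          by_cases h : ω ∈ A
          · simp [h, hf, S.relWealth_succ]
          · simp [h]
      _ = _ := hdis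
      _ = _ := by
          refine lintegral_congr fun ω => ?_
          by_cases h : ω ∈ A <;> simp [h]
  rw [hnext, ← lintegral_add_right _ (S.measurable_weighted_distance_sq L y₀ i t)]
  refine lintegral_mono_ae (ae_restrict_of_ae ?_)
  filter_upwards [S.ae_lintegral_neg_log_relStep K L y₀ hL t,
    S.ae_relWealth_pos K L hy₀ hL t] with ω hω hr
  exact (hω hr).2

end Growth

/-! ### Convergence of nonnegative supermartingales -/

section Convergence

variable {Ω : Type*} {mΩ : MeasurableSpace Ω} {P : Measure Ω} [IsProbabilityMeasure P]
  {ℱ : Filtration ℕ mΩ}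

/-- A nonnegative supermartingale converges almost surely, and the total of its conditional
expected decreases is almost surely finite. -/
theorem ae_tendsto_and_tsum_lt_top {Z : ℕ → Ω → ℝ} {δ : ℕ → Ω → ℝ≥0∞}
    (hZ : ∀ t, Measurable[ℱ t] (Z t)) (hZ0 : ∀ t ω, 0 ≤ Z t ω) (hδ : ∀ t, Measurable (δ t))
    (hfin : ∫⁻ ω, ENNReal.ofReal (Z 0 ω) ∂P ≠ ∞)
    (hstep : ∀ t A, MeasurableSet[ℱ t] A → ∫⁻ ω in A, ENNReal.ofReal (Z (t + 1) ω) ∂P +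
      ∫⁻ ω in A, δ t ω ∂P ≤ ∫⁻ ω in A, ENNReal.ofReal (Z t ω) ∂P) :
    ∀ᵐ ω ∂P, (∃ z, Tendsto (fun t => Z t ω) atTop (𝓝 z)) ∧ ∑' t, δ t ω < ∞ := by
  -- Telescoping `hstep` over the whole space bounds at once the `L¹` norms of `Z` and the total
  -- expected decrease.
  have htel : ∀ t, ∫⁻ ω, ENNReal.ofReal (Z t ω) ∂P + ∑ s ∈ Finset.range t, ∫⁻ ω, δ s ω ∂P ≤
      ∫⁻ ω, ENNReal.ofReal (Z 0 ω) ∂P := by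
    intro t
    induction t with
    | zero => simp
    | succ t ih =>
      refine le_trans ?_ ih
      rw [Finset.sum_range_succ, add_comm (∑ s ∈ Finset.range t, _), ← add_assoc]
      gcongr
      simpa using hstep t Set.univ MeasurableSet.univ
  have hle : ∀ t, ∫⁻ ω, ENNReal.ofReal (Z t ω) ∂P ≤ ∫⁻ ω, ENNReal.ofReal (Z 0 ω) ∂P :=
    fun t => le_self_add.trans (htel t)
  have hmeas : ∀ t, AEStronglyMeasurable (Z t) P := fun t =>
    ((hZ t).mono (ℱ.le t) le_rfl).aestronglyMeasurable
  have hint : ∀ t, Integrable (Z t) P := fun t => by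
    refine ⟨hmeas t, ?_⟩
    rw [hasFiniteIntegral_iff_ofReal (Eventually.of_forall (hZ0 t))]
    exact (hle t).trans_lt hfin.lt_top
  have hsuper : Supermartingale Z ℱ P := by
    refine supermartingale_of_setIntegral_succ_le (fun t => (hZ t).stronglyMeasurable) hint
      fun t A hA => ?_
    have hset : ∀ s, ∫ ω in A, Z s ω ∂P = (∫⁻ ω in A, ENNReal.ofReal (Z s ω) ∂P).toReal :=
      fun s => integral_eq_lintegral_of_nonneg_ae (Eventually.of_forall (hZ0 s))
        (hmeas s).restrict
    rw [hset, hset]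
    refine ENNReal.toReal_mono ?_ (le_self_add.trans (hstep t A hA))
    exact ne_top_of_le_ne_top hfin ((setLIntegral_le_lintegral _ _).trans (hle t))
  have hconv : ∀ᵐ ω ∂P, ∃ z, Tendsto (fun t => (-Z) t ω) atTop (𝓝 z) := by
    refine hsuper.neg.exists_ae_tendsto_of_bdd
      (R := (∫⁻ ω, ENNReal.ofReal (Z 0 ω) ∂P).toNNReal) fun t => ?_
    rw [ENNReal.coe_toNNReal hfin, eLpNorm_one_eq_lintegral_enorm]
    refine le_trans (le_of_eq (lintegral_congr fun ω => ?_)) (hle t)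
    rw [Pi.neg_apply, Pi.neg_apply, enorm_neg, Real.enorm_of_nonneg (hZ0 t ω)]
  have hsum : ∫⁻ ω, ∑' t, δ t ω ∂P ≠ ∞ := by
    rw [lintegral_tsum fun t => (hδ t).aemeasurable]
    refine ne_top_of_le_ne_top hfin (ENNReal.tsum_le_of_sum_range_le fun t => ?_)
    exact le_add_self.trans (htel t)
  filter_upwards [hconv, ae_lt_top (Measurable.tsum hδ) hsum] with ω h1 h2
  refine ⟨?_, h2⟩
  obtain ⟨z, hz⟩ := h1
  exact ⟨-z, by simpa using hz.neg⟩

end Convergence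

/-! ### Conclusion for the relative wealth -/

section Main

variable {Ω : Type*} {mΩ : MeasurableSpace Ω} {P : Measure Ω} [IsProbabilityMeasure P]
  {ℱ : Filtration ℕ mΩ} {M N : ℕ}

theorem Market.ae_tendsto_relWealth_and_tsum_lt_top (S : Market P ℱ N) (K : PayoffKernel S)
    (L : Fin M → Strategy ℱ M N) {y₀ : Fin M → ℝ≥0} {i : Fin M} (hy₀ : 0 < y₀ i)
    (hL : L i = optimalStrategy M S K) : ∀ᵐ ω ∂P,
      (∃ r, Tendsto (fun t => S.relWealth L y₀ t ω i) atTop (𝓝 r)) ∧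
      ∑' t, ENNReal.ofReal
        ((1 - S.relWealth L y₀ t ω i) ^ 2 / 4 * S.distance L y₀ i t ω ^ 2) < ∞ := by
  have h := ae_tendsto_and_tsum_lt_top (P := P) (ℱ := ℱ)
    (Z := fun t ω => -Real.log (S.relWealth L y₀ t ω i))
    (δ := fun t ω => ENNReal.ofReal
      ((1 - S.relWealth L y₀ t ω i) ^ 2 / 4 * S.distance L y₀ i t ω ^ 2))
    (fun t => (Real.measurable_log.comp (S.measurable_relWealth L y₀ t i)).neg)
    (fun t ω => neg_nonneg.2 (Real.log_nonpos (S.relWealth_nonneg L y₀ t ω i)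
      (S.relWealth_le_one L y₀ t ω i)))
    (S.measurable_weighted_distance_sq L y₀ i)
    (by
      change ∫⁻ _, ENNReal.ofReal (-Real.log ((y₀ i : ℝ) / ∑ k, (y₀ k : ℝ))) ∂P ≠ ∞
      simp)
    (fun t A hA => S.setLIntegral_neg_log_relWealth K L hy₀ hL t hA)
  filter_upwards [h, ae_all_iff.2 (S.ae_relWealth_pos K L hy₀ hL)] with ω hω hpos
  refine ⟨?_, hω.2⟩
  obtain ⟨z, hz⟩ := hω.1
  -- Convergence of `-log r_t` to the finite `z` gives this limit, using positivity of every `r_t`.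
  refine ⟨Real.exp (-z), ?_⟩
  refine ((Real.continuous_exp.tendsto _).comp hz.neg).congr fun t => ?_
  simp [Real.exp_log (hpos t)]

/-- The weights tend to a positive number and eventually exceed half of it, so comparison removes
them. -/
theorem tsum_ofReal_lt_top_of_weighted {r d : ℕ → ℝ} {a : ℝ} (hr : Tendsto r atTop (𝓝 a))
    (ha : a < 1) (h : ∑' t, ENNReal.ofReal ((1 - r t) ^ 2 / 4 * d t ^ 2) < ∞) :
    ∑' t, ENNReal.ofReal (d t ^ 2) < ∞ := by
  have hw : Summable fun t => (1 - r t) ^ 2 / 4 * d t ^ 2 := by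
    have := ENNReal.summable_toReal h.ne
    refine this.congr fun t => ?_
    rw [ENNReal.toReal_ofReal (by positivity)]
  have hε : 0 < (1 - a) ^ 2 / 4 := by
    have : 0 < 1 - a := sub_pos.2 ha
    positivity
  have hlim : Tendsto (fun t => (1 - r t) ^ 2 / 4) atTop (𝓝 ((1 - a) ^ 2 / 4)) :=
    ((tendsto_const_nhds.sub hr).pow 2).div_const 4
  have hev : ∀ᶠ t in atTop, (1 - a) ^ 2 / 4 / 2 < (1 - r t) ^ 2 / 4 :=
    hlim.eventually (lt_mem_nhds (half_lt_self hε))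
  have hs : Summable fun t => d t ^ 2 := by
    refine Summable.of_norm_bounded_eventually_nat (hw.mul_left ((1 - a) ^ 2 / 4 / 2)⁻¹) ?_
    filter_upwards [hev] with t ht
    rw [Real.norm_of_nonneg (sq_nonneg _), ← div_eq_inv_mul, le_div_iff₀ (half_pos hε), mul_comm]
    exact mul_le_mul_of_nonneg_right ht.le (sq_nonneg _)
  rw [← ENNReal.ofReal_tsum_of_nonneg (fun t => sq_nonneg _) hs]
  exact ENNReal.ofReal_lt_top

end Main

end AssetMarket

end

theorem theorem2 {Ω : Type*} {mΩ : MeasurableSpace Ω} (P : Measure Ω) [IsProbabilityMeasure P]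
    (ℱ : Filtration ℕ mΩ) (M N : ℕ) (hM : 2 ≤ M) (hN : 1 ≤ N)
    (S : AssetMarket.Market P ℱ N) (K : AssetMarket.PayoffKernel S)
    (y₀ : Fin M → ℝ≥0) (hy₀ : ∀ m, 0 < y₀ m)
    (L : Fin M → AssetMarket.Strategy ℱ M N)
    (hL : L ⟨0, by omega⟩ = AssetMarket.optimalStrategy M S K) :
    MeasurableSet {ω | ∑' t, ENNReal.ofReal (S.distance L y₀ ⟨0, by omega⟩ t ω ^ 2) = ∞} ∧
    (∀ᵐ ω ∂P, ∑' t, ENNReal.ofReal (S.distance L y₀ ⟨0, by omega⟩ t ω ^ 2) = ∞ →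
      Tendsto (fun t => S.relWealth L y₀ t ω ⟨0, by omega⟩) atTop (𝓝 1)) ∧
    (∀ᵐ ω ∂P, ∃ r : ℝ, Tendsto (fun t => S.relWealth L y₀ t ω ⟨0, by omega⟩) atTop (𝓝 r) ∧
      (r < 1 → Tendsto (fun t => S.distance L y₀ ⟨0, by omega⟩ t ω) atTop (𝓝 0))) := by
  have hae := S.ae_tendsto_relWealth_and_tsum_lt_top K L (hy₀ _) hL
  refine ⟨?_, ?_, ?_⟩
  · have hm : Measurable fun ω =>
        ∑' t, ENNReal.ofReal (S.distance L y₀ ⟨0, by omega⟩ t ω ^ 2) :=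
      Measurable.tsum fun t =>
        ((S.measurable_distance_sq L y₀ _ t).mono (ℱ.le t) le_rfl).ennreal_ofReal
    exact hm (measurableSet_singleton ∞)
  · filter_upwards [hae] with ω ⟨⟨r, hr⟩, hsum⟩ htop
    have hr1 : r ≤ 1 := le_of_tendsto' hr fun t => S.relWealth_le_one L y₀ t ω _
    rcases hr1.lt_or_eq with hlt | rfl
    · exact absurd htop (AssetMarket.tsum_ofReal_lt_top_of_weighted hr hlt hsum).ne
    · exact hr
  · filter_upwards [hae] with ω ⟨⟨r, hr⟩, hsum⟩
    refine ⟨r, hr, fun hlt => ?_⟩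
    have hfin := AssetMarket.tsum_ofReal_lt_top_of_weighted hr hlt hsum
    have hs := (ENNReal.summable_toReal hfin.ne).tendsto_atTop_zero
    have hs' := (Real.continuous_sqrt.tendsto _).comp hs
    rw [Real.sqrt_zero] at hs'
    refine hs'.congr fun t => ?_
    rw [Function.comp_apply, ENNReal.toReal_ofReal (sq_nonneg _)]
    exact Real.sqrt_sq (norm_nonneg _)
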